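/- Let $(M,g)$ be a non-empty smooth Riemannian manifold of dimension $n\ge 2$, with Levi-Civita connection $\dot\nabla$. For $p\in T^*M$ over $x=\pi(p)$ let $t=t(p)=\tfrac12 g^{-1}_x(p,p)$ be the energy density. For $X\in T_xM$ and $\theta\in T_x^*M$ let $X^H_p$ be the horizontal lift of $X$ with respect to $\dot\nabla$ and $\theta^V_p$ the vertical lift of $\theta$ to $T_p(T^*M)$; that is, in the chart $(q^i,p_i)$ of $T^*M$ induced by a chart of $M$, $\theta^V_p=\theta_i\,\frac{\partial}{\partial p_i}$ and $X^H_p=X^i\bigl(\frac{\partial}{\partial q^i}+p_k\Gamma^k_{ih}\frac{\partial}{\partial p_h}\bigr)$. Let $g_X=g(X,\cdot)$, and let $\theta^\sharp\in T_xM$ be the vector with $g_{\theta^\sharp}=\theta$. Let $a_1,a_2,b_1,b_2:[0,\infty)\to\mathbb R$ be smooth functions with $a_1>0$, $a_2>0$, $a_1+2tb_1>0$, $a_2+2tb_2>0$ for all $t\ge 0$, such that the tensor field $J$ of type $(1,1)$ on $T^*M$ given by $$JX^H_p=a_1(t)\,(g_X)^V_p+b_1(t)\,p(X)\,p^V_p,\qquad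 J\theta^V_p=-a_2(t)\,(\theta^\sharp)^H_p-b_2(t)\,g^{-1}_x(p,\theta)\,(p^\sharp)^H_p$$ is an almost complex structure, i.e. $J^2=-I$. Then $J$ is integrable, in the sense that its Nijenhuis tensor field $$N(X,Y)=[JX,JY]-J[JX,Y]-J[X,JY]-[X,Y]$$ vanishes for all smooth vector fields $X,Y$ on $T^*M$, if and only if there is a constant $c\in\mathbb R$ such that $(M,g)$ has constant sectional curvature $c$ and, for all $t\ge 0$, $a_1(t)-2t\,a_1'(t)\neq 0$ and $$b_1(t)=\frac{a_1(t)\,a_1'(t)-c}{a_1(t)-2t\,a_1'(t)}.$$ -/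

import Mathlib

set_option maxSynthPendingDepth 3

open Bundle Set
open scoped Manifold ContDiff Topology

noncomputable section

namespace CotangentLift

variable {E : Type*} [NormedAddCommGroup E] [NormedSpace ℝ E]
  {M : Type*} [TopologicalSpace M] [ChartedSpace E M]

/-! ### The Riemannian manifold `(M, g)` -/

variable (E M) in
/-- Smooth Riemannian metrics on the manifold `M` (modelled on `E`). -/
abbrev Metric [IsManifold 𝓘(ℝ, E) ∞ M] :=
  ContMDiffRiemannianMetric 𝓘(ℝ, E) ∞ E (fun x : M => TangentSpace 𝓘(ℝ, E) x)

/-- Cotangent vectors of `M` at `x`. -/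
abbrev Covector (x : M) := TangentSpace 𝓘(ℝ, E) x →L[ℝ] ℝ

variable [IsManifold 𝓘(ℝ, E) ∞ M] (g : Metric E M)

/-- The musical isomorphism `θ ↦ θ^♯`, the inverse of `X ↦ g_X = g(X, ·)`. -/
def sharp (x : M) : Covector (E := E) x →L[ℝ] TangentSpace 𝓘(ℝ, E) x :=
  (g.inner x).inverse

/-- In finite dimension `X ↦ g(X, ·)` is indeed invertible, with inverse `sharp`. -/
theorem inner_sharp [FiniteDimensional ℝ E] (x : M) (θ : Covector (E := E) x) :
    g.inner x (sharp g x θ) = θ := by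
  let B : E →L[ℝ] E →L[ℝ] ℝ := g.inner x
  have hinj : Function.Injective B.toLinearMap := by
    refine (injective_iff_map_eq_zero _).2 fun v hv => ?_
    by_contra hne
    have h1 : 0 < B v v := g.pos x v hne
    have h2 : B v v = 0 := congrArg (fun L : E →L[ℝ] ℝ => L v) hv
    exact h1.ne' h2
  have hfin : FiniteDimensional ℝ (E →L[ℝ] ℝ) :=
    (LinearMap.toContinuousLinearMap (𝕜 := ℝ) (E := E) (F' := ℝ)).finiteDimensional
  have hdim : Module.finrank ℝ E = Module.finrank ℝ (E →L[ℝ] ℝ) := by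
    rw [← (LinearMap.toContinuousLinearMap (𝕜 := ℝ) (E := E) (F' := ℝ)).finrank_eq]
    exact (Subspace.dual_finrank_eq (K := ℝ) (V := E)).symm
  let e : E ≃L[ℝ] (E →L[ℝ] ℝ) :=
    (LinearEquiv.ofInjectiveOfFinrankEq _ hinj hdim).toContinuousLinearEquiv
  have hinv : B.IsInvertible := ⟨e, rfl⟩
  exact congrArg (fun L : (E →L[ℝ] ℝ) →L[ℝ] (E →L[ℝ] ℝ) => L θ) hinv.self_comp_inverse

/-- The metric in the chart around `x₀`: at the point with coordinates `y`, the bilinear form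
`(u, v) ↦ g(∂_u, ∂_v)`, where `∂_u` is the coordinate vector field in the direction `u`. -/
def metricInChart (x₀ : M) (y : E) : E →L[ℝ] E →L[ℝ] ℝ :=
  let A : E →L[ℝ] TangentSpace 𝓘(ℝ, E) ((extChartAt 𝓘(ℝ, E) x₀).symm y) :=
    mfderiv 𝓘(ℝ, E) 𝓘(ℝ, E) (extChartAt 𝓘(ℝ, E) x₀).symm y
  (ContinuousLinearMap.precomp ℝ A).comp
    ((g.inner ((extChartAt 𝓘(ℝ, E) x₀).symm y)).comp A)

/-- Christoffel symbols of the first kind in the chart around `x₀`: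
`(u, v) ↦ (w ↦ (1/2) (D_u g(v, w) + D_v g(u, w) - D_w g(u, v)))`. -/
def christoffelFirst (x₀ : M) (y : E) : E →L[ℝ] E →L[ℝ] E →L[ℝ] ℝ :=
  let D : E →L[ℝ] E →L[ℝ] E →L[ℝ] ℝ := fderiv ℝ (metricInChart g x₀) y
  (1 / 2 : ℝ) • (D + D.flip -
    (ContinuousLinearMap.flipₗᵢ ℝ E E ℝ).toContinuousLinearEquiv.toContinuousLinearMap.comp D.flip)

/-- Christoffel symbols `Γ(u, v) = Γ^k_{ij} u^i v^j ∂_k` of the Levi-Civita connection in the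
chart around `x₀`. -/
def christoffel (x₀ : M) (y : E) : E →L[ℝ] E →L[ℝ] E :=
  (ContinuousLinearMap.compL ℝ E (E →L[ℝ] ℝ) E (metricInChart g x₀ y).inverse).comp
    (christoffelFirst g x₀ y)

/-- The curvature tensor `R(u, v) w` of the Levi-Civita connection at `x`, computed in the chart
around `x` (whose coordinate frame at `x` identifies `T_x M` with `E`). -/
def curvature (x : M) (u v w : TangentSpace 𝓘(ℝ, E) x) : TangentSpace 𝓘(ℝ, E) x :=
  let y : E := extChartAt 𝓘(ℝ, E) x x
  let Γ : E → E →L[ℝ] E →L[ℝ] E := christoffel g x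
  let R : E → E → E → E := fun u v w =>
    fderiv ℝ Γ y u v w - fderiv ℝ Γ y v u w + Γ y u (Γ y v w) - Γ y v (Γ y u w)
  R u v w

/-- The sectional curvature of the plane spanned by `u` and `v`. -/
def sectionalCurvature (x : M) (u v : TangentSpace 𝓘(ℝ, E) x) : ℝ :=
  g.inner x (curvature g x u v v) u /
    (g.inner x u u * g.inner x v v - g.inner x u v ^ 2)

/-- `(M, g)` has constant sectional curvature `c`. -/
def HasConstantSectionalCurvature (c : ℝ) : Prop :=
  ∀ (x : M) (u v : TangentSpace 𝓘(ℝ, E) x), LinearIndependent ℝ ![u, v] →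
    sectionalCurvature g x u v = c

/-! ### The cotangent bundle and the lifts to it -/

variable (E M) in
/-- The cotangent bundle `T^*M`, with Mathlib's smooth structure: its charts are those induced by
the charts of `M`. -/
abbrev CotangentBundle :=
  TotalSpace (E →L[ℝ] ℝ) (fun x : M => TangentSpace 𝓘(ℝ, E) x →L[ℝ] Bundle.Trivial M ℝ x)

variable (E) in
/-- The model of the manifold `T^*M`. -/
abbrev cotangentModel := (𝓘(ℝ, E)).prod 𝓘(ℝ, E →L[ℝ] ℝ)

/-- The tangent space of `T^*M` at `p`. By definition it is `E × (E →L[ℝ] ℝ)`, a pair `(u, η)`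
standing for `u^i ∂/∂q^i + η_i ∂/∂p_i` in the chart induced by the chart of `M` around `π(p)`. -/
abbrev TangentCotangent (p : CotangentBundle E M) := TangentSpace (cotangentModel E) p

/-- The cotangent vector `p` as a linear form on `T_{π(p)} M`. -/
def form (p : CotangentBundle E M) : Covector (E := E) p.1 := p.2

/-- `Γ⁰ : X ↦ Γ⁰_{ih} X^i dx^h`, where `Γ⁰_{ih} = p_k Γ^k_{ih}`, at the cotangent vector `p`. -/
def gammaZero (p : CotangentBundle E M) : E →L[ℝ] (E →L[ℝ] ℝ) :=
  (ContinuousLinearMap.compL ℝ E E ℝ (show E →L[ℝ] ℝ from form p)).comp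
    (christoffel g p.1 (extChartAt 𝓘(ℝ, E) p.1 p.1))

/-- Vertical lift `θ^V_p = θ_i ∂/∂p_i`. -/
def verticalLift (p : CotangentBundle E M) : Covector (E := E) p.1 →L[ℝ] TangentCotangent p :=
  show (E →L[ℝ] ℝ) →L[ℝ] E × (E →L[ℝ] ℝ) from ContinuousLinearMap.inr ℝ E (E →L[ℝ] ℝ)

/-- Horizontal lift `X^H_p = X^i (∂/∂q^i + Γ⁰_{ih} ∂/∂p_h)`. -/
def horizontalLift (p : CotangentBundle E M) :
    TangentSpace 𝓘(ℝ, E) p.1 →L[ℝ] TangentCotangent p :=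
  show E →L[ℝ] E × (E →L[ℝ] ℝ) from (ContinuousLinearMap.id ℝ E).prod (gammaZero g p)

/-- The vector of `T_{π(p)} M` whose horizontal lift is the horizontal part of `v`, that is
`π_* v`. -/
def horizontalPart (p : CotangentBundle E M) :
    TangentCotangent p →L[ℝ] TangentSpace 𝓘(ℝ, E) p.1 :=
  show E × (E →L[ℝ] ℝ) →L[ℝ] E from ContinuousLinearMap.fst ℝ E (E →L[ℝ] ℝ)

/-- The covector at `π(p)` whose vertical lift is the vertical part of `v`, that is
`v ↦ Dp_i(v) dx^i`, where `Dp_i = dp_i - Γ⁰_{ij} dq^j`. -/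
def verticalPart (p : CotangentBundle E M) :
    TangentCotangent p →L[ℝ] Covector (E := E) p.1 :=
  show E × (E →L[ℝ] ℝ) →L[ℝ] (E →L[ℝ] ℝ) from
    ContinuousLinearMap.snd ℝ E (E →L[ℝ] ℝ) -
      (gammaZero g p).comp (ContinuousLinearMap.fst ℝ E (E →L[ℝ] ℝ))

/-- The decomposition `T T^*M = H T^*M ⊕ V T^*M`. -/
theorem horizontal_add_vertical (p : CotangentBundle E M) (v : TangentCotangent p) :
    horizontalLift g p (horizontalPart p v) + verticalLift p (verticalPart g p v) = v := by
  let w : E × (E →L[ℝ] ℝ) := v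
  have h : (w.1, gammaZero g p w.1) + (0, w.2 - gammaZero g p w.1) = w := by ext <;> simp
  exact h

/-! ### The natural diagonal tensor field `J` -/

/-- The energy density `t(p) = (1/2) g⁻¹(p, p)`. -/
def energy (p : CotangentBundle E M) : ℝ :=
  (1 / 2 : ℝ) * form p (sharp g p.1 (form p))

/-- The natural tensor field of diagonal type with coefficients `a₁, a₂, b₁, b₂`, given by
`J X^H_p = a₁(t) (g_X)^V_p + b₁(t) p(X) p^V_p` and
`J θ^V_p = - a₂(t) (θ^♯)^H_p - b₂(t) g⁻¹(p, θ) (p^♯)^H_p`, where `t` is the energy density. -/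
def naturalJ (a₁ a₂ b₁ b₂ : ℝ → ℝ) (p : CotangentBundle E M) (v : TangentCotangent p) :
    TangentCotangent p :=
  let t := energy g p
  let X := horizontalPart p v
  let θ := verticalPart g p v
  (a₁ t • verticalLift p (g.inner p.1 X) +
      (b₁ t * form p X) • verticalLift p (form p)) +
    (-(a₂ t • horizontalLift g p (sharp g p.1 θ)) -
      (b₂ t * form p (sharp g p.1 θ)) • horizontalLift g p (sharp g p.1 (form p)))

theorem naturalJ_horizontalLift (a₁ a₂ b₁ b₂ : ℝ → ℝ) (p : CotangentBundle E M)
    (X : TangentSpace 𝓘(ℝ, E) p.1) :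
    naturalJ g a₁ a₂ b₁ b₂ p (horizontalLift g p X) =
      a₁ (energy g p) • verticalLift p (g.inner p.1 X) +
        (b₁ (energy g p) * form p X) • verticalLift p (form p) := by
  have h1 : horizontalPart p (horizontalLift g p X) = X := rfl
  have h2 : verticalPart g p (horizontalLift g p X) = 0 :=
    sub_self (gammaZero g p (X : E))
  simp [naturalJ, h1, h2]

theorem naturalJ_verticalLift (a₁ a₂ b₁ b₂ : ℝ → ℝ) (p : CotangentBundle E M)
    (θ : Covector (E := E) p.1) :
    naturalJ g a₁ a₂ b₁ b₂ p (verticalLift p θ) =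
      -(a₂ (energy g p) • horizontalLift g p (sharp g p.1 θ)) -
        (b₂ (energy g p) * form p (sharp g p.1 θ)) •
          horizontalLift g p (sharp g p.1 (form p)) := by
  have h1 : horizontalPart p (verticalLift p θ) = 0 := rfl
  have h2 : verticalPart g p (verticalLift p θ) = θ := by
    have h : ∀ η : E →L[ℝ] ℝ, η - gammaZero g p 0 = η := fun η => by simp
    exact h θ
  simp [naturalJ, h1, h2]

/-! ### Almost complex structures and integrability -/

/-- `J` is an almost complex structure on `T^*M`: `J² = - I`. -/
def IsAlmostComplex (J : ∀ p : CotangentBundle E M, TangentCotangent p → TangentCotangent p) :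
    Prop :=
  ∀ (p : CotangentBundle E M) (v : TangentCotangent p), J p (J p v) = -v

/-- A vector field `X` on `T^*M` is smooth. -/
def IsSmoothField (X : ∀ p : CotangentBundle E M, TangentCotangent p) : Prop :=
  ContMDiff (cotangentModel E) (cotangentModel E).tangent ∞
    (fun p => (⟨p, X p⟩ : TangentBundle (cotangentModel E) (CotangentBundle E M)))

/-- The Nijenhuis tensor field
`N(X, Y) = [JX, JY] - J[JX, Y] - J[X, JY] - [X, Y]`. -/
def nijenhuis (J : ∀ p : CotangentBundle E M, TangentCotangent p → TangentCotangent p)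
    (X Y : ∀ p : CotangentBundle E M, TangentCotangent p) (p : CotangentBundle E M) :
    TangentCotangent p :=
  VectorField.mlieBracket (cotangentModel E) (fun q => J q (X q)) (fun q => J q (Y q)) p
    - J p (VectorField.mlieBracket (cotangentModel E) (fun q => J q (X q)) Y p)
    - J p (VectorField.mlieBracket (cotangentModel E) X (fun q => J q (Y q)) p)
    - VectorField.mlieBracket (cotangentModel E) X Y p

/-- `J` is integrable: its Nijenhuis tensor field vanishes. -/
def IsIntegrable (J : ∀ p : CotangentBundle E M, TangentCotangent p → TangentCotangent p) :
    Prop :=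
  ∀ X Y : ∀ p : CotangentBundle E M, TangentCotangent p,
    IsSmoothField X → IsSmoothField Y → ∀ p, nijenhuis J X Y p = 0

end CotangentLift

end

noncomputable section

namespace CotangentLift

/-! The Nijenhuis tensor `N` is tensorial and satisfies `N(JX, Y) = N(X, JY) = -J N(X, Y)`. Since
`J` carries the horizontal distribution onto the vertical one, `N` vanishes as soon as it vanishes
on pairs of horizontal vectors. In a chart, take the horizontal lifts of constant coordinate fields
`u`, `v`. The mixed brackets `[JX, Y]` and `[X, JY]` cancel because the Levi-Civita connection is
torsion-free and metric; `[JX, JY]` and `[X, Y]` are vertical, and what remains is the vertical lift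
of `φ(t) (p(u) g_v - p(v) g_u) - p ∘ R(u, v)`, with `φ = (a₁ + 2 t b₁) a₁' - a₁ b₁`
(`IsMetricOn.nijenhuisTensor_horizontal`). Integrability therefore means `p ∘ R(u, v) = φ(t) (p(u)
g_v - p(v) g_u)` for all `p`, `u`, `v` (`isIntegrable_naturalJ_iff`).

The left side is linear in `p`, whereas `t` is quadratic. Putting `p = r g_u` and varying `r` forces
`φ` to be constant on `(0, ∞)`, hence on `[0, ∞)` by continuity, and its value `c` is the sectional
curvature at every point at once, so Schur's lemma is not needed
(`exists_hasConstantSectionalCurvature`). Conversely, constant sectional curvature determines the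
whole curvature tensor (`IsMetricOn.curvature_eq_of_sectional`).

It remains to solve `φ = c` for `b₁`, that is `b₁ (a₁ - 2 t a₁') = a₁ a₁' - c`. The factor on the
left cannot vanish: its product with `a₁ + 2 t b₁ > 0` is `a₁² - 2 c t`, which solves a linear
homogeneous differential equation and is positive at `0` (`coefficient_eq_div`).

The local computation applies on `T^*M` because the local expression of `J` is invariant under
coordinate changes (`modelJ_transform`). -/

section Nijenhuis

/-! ### The Nijenhuis tensor on a normed space -/

open VectorField

variable {F : Type*} [NormedAddCommGroup F] [NormedSpace ℝ F]

/-- The Nijenhuis bracket of two vector fields on a normed space. -/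
def modelNijenhuis (J : F → F →L[ℝ] F) (X Y : F → F) (z : F) : F :=
  lieBracket ℝ (fun z => J z (X z)) (fun z => J z (Y z)) z
    - J z (lieBracket ℝ (fun z => J z (X z)) Y z)
    - J z (lieBracket ℝ X (fun z => J z (Y z)) z) - lieBracket ℝ X Y z

/-- The Nijenhuis tensor at a point, expressed through the derivative of `J`. -/
def nijenhuisTensor (J : F → F →L[ℝ] F) (z u v : F) : F :=
  fderiv ℝ J z (J z u) v - fderiv ℝ J z (J z v) u - J z (fderiv ℝ J z u v)
    + J z (fderiv ℝ J z v u)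

/-- By the product rule the derivatives of `X` and `Y` enter linearly, and `J² = -1` at the single
point `z` makes them cancel. -/
theorem modelNijenhuis_eq_tensor {J : F → F →L[ℝ] F} {X Y : F → F} {z : F}
    (hJ : DifferentiableAt ℝ J z) (hX : DifferentiableAt ℝ X z) (hY : DifferentiableAt ℝ Y z)
    (hJJ : ∀ v, J z (J z v) = -v) :
    modelNijenhuis J X Y z = nijenhuisTensor J z (X z) (Y z) := by
  have h1 := (hJ.hasFDerivAt.clm_apply hX.hasFDerivAt).fderiv
  have h2 := (hJ.hasFDerivAt.clm_apply hY.hasFDerivAt).fderiv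
  simp only [modelNijenhuis, nijenhuisTensor, lieBracket_eq, h1, h2]
  simp [hJJ]
  abel

theorem nijenhuisTensor_swap (J : F → F →L[ℝ] F) (z u v : F) :
    nijenhuisTensor J z v u = -nijenhuisTensor J z u v := by
  simp only [nijenhuisTensor]; abel

theorem nijenhuisTensor_add_left (J : F → F →L[ℝ] F) (z u u' v : F) :
    nijenhuisTensor J z (u + u') v = nijenhuisTensor J z u v + nijenhuisTensor J z u' v := by
  simp only [nijenhuisTensor, map_add, add_apply]; abel

theorem nijenhuisTensor_add_right (J : F → F →L[ℝ] F) (z u v v' : F) :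
    nijenhuisTensor J z u (v + v') = nijenhuisTensor J z u v + nijenhuisTensor J z u v' := by
  simp only [nijenhuisTensor, map_add, add_apply]; abel

/-- Differentiating `J² = -1`, which must hold near `z`, shows that every directional derivative of
`J` anticommutes with `J`. -/
theorem nijenhuisTensor_apply_right {J : F → F →L[ℝ] F} {z : F}
    (hJ : DifferentiableAt ℝ J z) (hJJ : ∀ᶠ z' in 𝓝 z, ∀ v, J z' (J z' v) = -v) (u v : F) :
    nijenhuisTensor J z u (J z v) = -J z (nijenhuisTensor J z u v) := by
  have hz := hJJ.self_of_nhds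
  have key : ∀ w x : F, fderiv ℝ J z w (J z x) = -J z (fderiv ℝ J z w x) := by
    intro w x
    have hc : (fun z' => J z' (J z' x)) =ᶠ[𝓝 z] fun _ => -x := hJJ.mono fun z' h => h x
    have h1 := hc.fderiv_eq (𝕜 := ℝ)
    have h2 := hJ.hasFDerivAt.clm_apply
      (hJ.hasFDerivAt.clm_apply (hasFDerivAt_const x z))
    rw [h2.fderiv] at h1
    have h3 := congrArg (fun L : F →L[ℝ] F => L w) h1
    simp at h3
    exact eq_neg_of_add_eq_zero_right h3
  simp only [nijenhuisTensor, key, hz, map_add, map_sub, map_neg, neg_neg]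
  simp
  abel

theorem nijenhuisTensor_apply_left {J : F → F →L[ℝ] F} {z : F}
    (hJ : DifferentiableAt ℝ J z) (hJJ : ∀ᶠ z' in 𝓝 z, ∀ v, J z' (J z' v) = -v) (u v : F) :
    nijenhuisTensor J z (J z u) v = -J z (nijenhuisTensor J z u v) := by
  rw [nijenhuisTensor_swap, nijenhuisTensor_apply_right hJ hJJ, nijenhuisTensor_swap J z u v]
  simp

/-- The Nijenhuis tensor vanishes as soon as it vanishes on a subspace spanning together with its
image under `J`. -/
theorem nijenhuisTensor_eq_zero_of_span {J : F → F →L[ℝ] F} {z : F}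
    (hJ : DifferentiableAt ℝ J z) (hJJ : ∀ᶠ z' in 𝓝 z, ∀ v, J z' (J z' v) = -v) {H : Set F}
    (hspan : ∀ w, ∃ u ∈ H, ∃ v ∈ H, w = u + J z v)
    (h0 : ∀ u ∈ H, ∀ v ∈ H, nijenhuisTensor J z u v = 0) (u v : F) :
    nijenhuisTensor J z u v = 0 := by
  obtain ⟨a, ha, b, hb, rfl⟩ := hspan u
  obtain ⟨c, hc, d, hd, rfl⟩ := hspan v
  simp only [nijenhuisTensor_add_left, nijenhuisTensor_add_right,
    nijenhuisTensor_apply_left hJ hJJ, nijenhuisTensor_apply_right hJ hJJ,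
    h0 a ha c hc, h0 a ha d hd, h0 b hb c hc, h0 b hb d hd, map_zero, neg_zero, add_zero]

end Nijenhuis

section LocalMetric

/-! ### Riemannian metrics on open subsets of a normed space -/

variable {E : Type*} [NormedAddCommGroup E] [NormedSpace ℝ E]

/-- The Christoffel form of the first kind attached to the derivative `D` of a metric. -/
def firstKind (D : E →L[ℝ] E →L[ℝ] E →L[ℝ] ℝ) : E →L[ℝ] E →L[ℝ] E →L[ℝ] ℝ :=
  (1 / 2 : ℝ) • (D + D.flip -
    (ContinuousLinearMap.flipₗᵢ ℝ E E ℝ).toContinuousLinearEquiv.toContinuousLinearMap.comp D.flip)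

theorem firstKind_apply (D : E →L[ℝ] E →L[ℝ] E →L[ℝ] ℝ) (u v w : E) :
    firstKind D u v w = (1 / 2 : ℝ) * (D u v w + D v u w - D w u v) := by
  simp [firstKind]

/-- The Christoffel symbols of a metric on a normed space. -/
def modelChristoffel (G : E → E →L[ℝ] E →L[ℝ] ℝ) (y : E) : E →L[ℝ] E →L[ℝ] E :=
  (ContinuousLinearMap.compL ℝ E (E →L[ℝ] ℝ) E (G y).inverse).comp (firstKind (fderiv ℝ G y))

/-- The curvature tensor of a connection on a normed space. -/
def modelCurvature (Γ : E → E →L[ℝ] E →L[ℝ] E) (y u v w : E) : E :=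
  fderiv ℝ Γ y u v w - fderiv ℝ Γ y v u w + Γ y u (Γ y v w) - Γ y v (Γ y u w)

/-- `G` is a smooth Riemannian metric on the open set `s`. -/
structure IsMetricOn (G : E → E →L[ℝ] E →L[ℝ] ℝ) (s : Set E) : Prop where
  isOpen : IsOpen s
  contDiffOn : ContDiffOn ℝ ∞ G s
  symm : ∀ y ∈ s, ∀ u v, G y u v = G y v u
  pos : ∀ y ∈ s, ∀ u, u ≠ 0 → 0 < G y u u

/-- A positive definite bilinear form is invertible in finite dimension. -/
theorem isInvertible_of_pos [FiniteDimensional ℝ E] {B : E →L[ℝ] E →L[ℝ] ℝ}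
    (hB : ∀ u, u ≠ 0 → 0 < B u u) : B.IsInvertible := by
  have hinj : Function.Injective B.toLinearMap := by
    refine (injective_iff_map_eq_zero _).2 fun v hv => ?_
    by_contra hne
    have h2 : B v v = 0 := congrArg (fun L : E →L[ℝ] ℝ => L v) hv
    exact (hB v hne).ne' h2
  have hfin : FiniteDimensional ℝ (E →L[ℝ] ℝ) :=
    (LinearMap.toContinuousLinearMap (𝕜 := ℝ) (E := E) (F' := ℝ)).finiteDimensional
  have hdim : Module.finrank ℝ E = Module.finrank ℝ (E →L[ℝ] ℝ) := by
    rw [← (LinearMap.toContinuousLinearMap (𝕜 := ℝ) (E := E) (F' := ℝ)).finrank_eq]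
    exact (Subspace.dual_finrank_eq (K := ℝ) (V := E)).symm
  exact ⟨(LinearEquiv.ofInjectiveOfFinrankEq _ hinj hdim).toContinuousLinearEquiv, rfl⟩

/-- With `u = B⁻¹ p` one has `p u = B u u`. This keeps the energy in `[0, ∞)`, where the
coefficients are smooth. -/
theorem half_apply_inverse_nonneg [FiniteDimensional ℝ E] {B : E →L[ℝ] E →L[ℝ] ℝ}
    (hB : ∀ u, u ≠ 0 → 0 < B u u) (p : E →L[ℝ] ℝ) : 0 ≤ 1 / 2 * p (B.inverse p) := by
  have h := congrArg (fun L : (E →L[ℝ] ℝ) →L[ℝ] (E →L[ℝ] ℝ) => L p (B.inverse p))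
    (isInvertible_of_pos hB).self_comp_inverse
  have h' : B (B.inverse p) (B.inverse p) = p (B.inverse p) := h
  rw [← h']
  by_cases h0 : B.inverse p = 0
  · simp [h0]
  · have := hB _ h0
    positivity

namespace IsMetricOn

variable {G : E → E →L[ℝ] E →L[ℝ] ℝ} {s : Set E} {y : E}

theorem contDiffAt (hG : IsMetricOn G s) (hy : y ∈ s) : ContDiffAt ℝ ∞ G y :=
  hG.contDiffOn.contDiffAt (hG.isOpen.mem_nhds hy)

theorem differentiableAt (hG : IsMetricOn G s) (hy : y ∈ s) : DifferentiableAt ℝ G y :=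
  (hG.contDiffAt hy).differentiableAt (by simp)

theorem fderiv_symm (hG : IsMetricOn G s) (hy : y ∈ s) (w u v : E) :
    fderiv ℝ G y w u v = fderiv ℝ G y w v u := by
  have hc : (fun y => G y u v) =ᶠ[𝓝 y] fun y => G y v u :=
    Filter.eventually_of_mem (hG.isOpen.mem_nhds hy) fun y hy => hG.symm y hy u v
  have hd := (hG.differentiableAt hy).hasFDerivAt
  have h : ∀ a b : E, fderiv ℝ (fun y => G y a b) y w = fderiv ℝ G y w a b := by
    intro a b
    have := ((hd.clm_apply (hasFDerivAt_const a y)).clm_apply (hasFDerivAt_const b y)).fderiv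
    rw [this]; simp
  rw [← h, ← h, hc.fderiv_eq]

variable [FiniteDimensional ℝ E]

theorem isInvertible (hG : IsMetricOn G s) (hy : y ∈ s) : (G y).IsInvertible :=
  isInvertible_of_pos (hG.pos y hy)

theorem apply_inverse (hG : IsMetricOn G s) (hy : y ∈ s) (θ : E →L[ℝ] ℝ) :
    G y ((G y).inverse θ) = θ :=
  congrArg (fun L : (E →L[ℝ] ℝ) →L[ℝ] (E →L[ℝ] ℝ) => L θ) (hG.isInvertible hy).self_comp_inverse

theorem injective (hG : IsMetricOn G s) (hy : y ∈ s) : Function.Injective (G y) :=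
  (hG.isInvertible hy).injective

theorem apply_christoffel (hG : IsMetricOn G s) (hy : y ∈ s) (u v w : E) :
    G y (modelChristoffel G y u v) w =
      (1 / 2 : ℝ) * (fderiv ℝ G y u v w + fderiv ℝ G y v u w - fderiv ℝ G y w u v) := by
  rw [← firstKind_apply]
  exact congrArg (fun L : E →L[ℝ] ℝ => L w) (hG.apply_inverse hy (firstKind (fderiv ℝ G y) u v))

theorem christoffel_symm (hG : IsMetricOn G s) (hy : y ∈ s) (u v : E) :
    modelChristoffel G y u v = modelChristoffel G y v u := by
  refine hG.injective hy (ContinuousLinearMap.ext fun w => ?_)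
  rw [hG.apply_christoffel hy, hG.apply_christoffel hy, hG.fderiv_symm hy w u v]
  ring

/-- The Levi-Civita connection is compatible with the metric. -/
theorem fderiv_eq (hG : IsMetricOn G s) (hy : y ∈ s) (w u v : E) :
    fderiv ℝ G y w u v =
      G y (modelChristoffel G y w u) v + G y u (modelChristoffel G y w v) := by
  rw [hG.symm y hy u, hG.apply_christoffel hy, hG.apply_christoffel hy, hG.fderiv_symm hy u w v,
    hG.fderiv_symm hy v w u, hG.fderiv_symm hy w v u]
  ring

theorem contDiffAt_inverse (hG : IsMetricOn G s) (hy : y ∈ s) :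
    ContDiffAt ℝ ∞ (fun y => (G y).inverse) y := by
  obtain ⟨e, he⟩ := hG.isInvertible hy
  have h := contDiffAt_map_inverse (𝕜 := ℝ) (n := ∞) e
  rw [he] at h
  exact h.comp y (hG.contDiffAt hy)

theorem contDiffAt_christoffel (hG : IsMetricOn G s) (hy : y ∈ s) :
    ContDiffAt ℝ ∞ (modelChristoffel G) y := by
  have h1 : ContDiffAt ℝ ∞ (fderiv ℝ G) y := (hG.contDiffAt hy).fderiv_right (by simp)
  have h2 := hG.contDiffAt_inverse hy
  have h3 : ContDiffAt ℝ ∞ (fun y => firstKind (fderiv ℝ G y)) y := by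
    unfold firstKind
    have h1' : ContDiffAt ℝ ∞ (fun y => (fderiv ℝ G y).flip) y :=
      (ContinuousLinearMap.flipₗᵢ ℝ E E
        (E →L[ℝ] ℝ)).toContinuousLinearEquiv.contDiff.contDiffAt.comp y h1
    have h4 : ContDiffAt ℝ ∞ (fun y => fderiv ℝ G y + (fderiv ℝ G y).flip) y := h1.add h1'
    have h5 : ContDiffAt ℝ ∞ (fun y => (ContinuousLinearMap.flipₗᵢ ℝ E E
        ℝ).toContinuousLinearEquiv.toContinuousLinearMap.comp (fderiv ℝ G y).flip) y :=
      contDiffAt_const.clm_comp h1'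
    have h6 := h4.sub h5
    exact h6.const_smul (1 / 2 : ℝ)
  exact ((ContinuousLinearMap.compL ℝ E (E →L[ℝ] ℝ) E).contDiff.contDiffAt.comp y h2).clm_comp h3

theorem differentiableAt_christoffel (hG : IsMetricOn G s) (hy : y ∈ s) :
    DifferentiableAt ℝ (modelChristoffel G) y :=
  (hG.contDiffAt_christoffel hy).differentiableAt (by simp)

/-- Metric compatibility differentiated once more expresses `D²G` through `Γ` and `DΓ`. Symmetry of
`D²G` in `u`, `v` cancels the products `G(Γ, Γ)` and leaves skewness of `R(u, v)`. -/
theorem curvature_skew (hG : IsMetricOn G s) (hy : y ∈ s) (u v w z : E) :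
    G y (modelCurvature (modelChristoffel G) y u v w) z =
      -G y (modelCurvature (modelChristoffel G) y u v z) w := by
  set Γ := modelChristoffel G with hΓ
  have hd := (hG.differentiableAt hy).hasFDerivAt
  have hdΓ := (hG.differentiableAt_christoffel hy).hasFDerivAt
  have h2 : ContDiffAt ℝ ∞ (fderiv ℝ G) y := (hG.contDiffAt hy).fderiv_right (by simp)
  have hd2 := (h2.differentiableAt (by simp)).hasFDerivAt
  have key : ∀ a b : E, fderiv ℝ (fderiv ℝ G) y a b w z =
      G y (Γ y a (Γ y b w)) z + G y (Γ y b w) (Γ y a z) + G y (fderiv ℝ Γ y a b w) z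
      + (G y (Γ y a w) (Γ y b z) + G y w (Γ y a (Γ y b z)) + G y w (fderiv ℝ Γ y a b z)) := by
    intro a b
    have hc : (fun y => fderiv ℝ G y b w z) =ᶠ[𝓝 y]
        fun y => G y (Γ y b w) z + G y w (Γ y b z) :=
      Filter.eventually_of_mem (hG.isOpen.mem_nhds hy) fun y hy => hG.fderiv_eq hy b w z
    have e1 := ((hd2.clm_apply (hasFDerivAt_const b y)).clm_apply
      (hasFDerivAt_const w y)).clm_apply (hasFDerivAt_const z y)
    have hg (c : E) := (hdΓ.clm_apply (hasFDerivAt_const b y)).clm_apply (hasFDerivAt_const c y)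
    have e2 := ((hd.clm_apply (hg w)).clm_apply (hasFDerivAt_const z y)).add
      ((hd.clm_apply (hasFDerivAt_const w y)).clm_apply (hg z))
    have e3 := congrArg (fun L : E →L[ℝ] ℝ => L a) (e1.unique (e2.congr_of_eventuallyEq hc))
    simp [hG.fderiv_eq hy, ← hΓ] at e3
    rw [e3]; ring
  have hs := (hG.contDiffAt hy).isSymmSndFDerivAt (n := ∞)
    (by simpa using WithTop.coe_le_coe.2 (le_top : (2 : ℕ∞) ≤ ⊤)) u v
  have hs' := congrArg (fun L : E →L[ℝ] E →L[ℝ] ℝ => L w z) hs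
  simp only [key] at hs'
  have hsym := hG.symm y hy
  simp only [modelCurvature, map_add, map_sub, add_apply, sub_apply]
  have e1 := hsym w (Γ y u (Γ y v z))
  have e2 := hsym w (Γ y v (Γ y u z))
  have e3 := hsym w (fderiv ℝ Γ y u v z)
  have e4 := hsym w (fderiv ℝ Γ y v u z)
  linarith

theorem fderiv_christoffel_symm (hG : IsMetricOn G s) (hy : y ∈ s) (w u v : E) :
    fderiv ℝ (modelChristoffel G) y w u v = fderiv ℝ (modelChristoffel G) y w v u := by
  have hc : (fun y => modelChristoffel G y u v) =ᶠ[𝓝 y] fun y => modelChristoffel G y v u :=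
    Filter.eventually_of_mem (hG.isOpen.mem_nhds hy) fun y hy => hG.christoffel_symm hy u v
  have hd := (hG.differentiableAt_christoffel hy).hasFDerivAt
  have h : ∀ a b : E, fderiv ℝ (fun y => modelChristoffel G y a b) y w =
      fderiv ℝ (modelChristoffel G) y w a b := by
    intro a b
    have := ((hd.clm_apply (hasFDerivAt_const a y)).clm_apply (hasFDerivAt_const b y)).fderiv
    rw [this]; simp
  rw [← h, ← h, hc.fderiv_eq]

/-- First Bianchi identity. -/
theorem curvature_cyclic (hG : IsMetricOn G s) (hy : y ∈ s) (u v w : E) :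
    modelCurvature (modelChristoffel G) y u v w + modelCurvature (modelChristoffel G) y v w u
      + modelCurvature (modelChristoffel G) y w u v = 0 := by
  simp only [modelCurvature]
  rw [hG.fderiv_christoffel_symm hy u w v, hG.fderiv_christoffel_symm hy v w u,
    hG.fderiv_christoffel_symm hy w v u, hG.christoffel_symm hy v w, hG.christoffel_symm hy u w,
    hG.christoffel_symm hy u v]
  abel

end IsMetricOn

theorem modelCurvature_swap (Γ : E → E →L[ℝ] E →L[ℝ] E) (y u v w : E) :
    modelCurvature Γ y v u w = -modelCurvature Γ y u v w := by
  simp only [modelCurvature]; abel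

/-- An algebraic curvature tensor with vanishing sectional curvatures vanishes. -/
theorem algebraicCurvature_eq_zero {V : Type*} [AddCommGroup V] {S : V → V → V → V → ℝ}
    (hadd : ∀ u v v' w z, S u (v + v') w z = S u v w z + S u v' w z)
    (h12 : ∀ u v w z, S v u w z = -S u v w z) (h34 : ∀ u v w z, S u v z w = -S u v w z)
    (hcyc : ∀ u v w z, S u v w z + S v w u z + S w u v z = 0)
    (hsec : ∀ u v, S u v v u = 0) (u v w z : V) : S u v w z = 0 := by
  -- Pair symmetry, from the four cyclic identities on `a, b, c, d`.
  have hpair : ∀ a b c d, S a b c d = S c d a b := by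
    intro a b c d
    have := hcyc a b c d
    have := hcyc b c d a
    have := hcyc c d a b
    have := hcyc d a b c
    have := h34 a b c d
    have := h34 b c d a
    have := h34 c d a b
    have := h34 d a b c
    have := h34 c a b d
    have := h34 d b c a
    have := h12 c a b d
    have := h12 d b c a
    have := h12 c a d b
    have := h12 b d a c
    have := h12 b d c a
    have := h34 b d c a
    have := h34 a c b d
    linarith
  -- Polarisation: `S a · · a` is a symmetric biadditive form with zero diagonal.
  have h0 : ∀ a b c, S a b c a = 0 := by
    intro a b c
    have e1 := hsec a (b + c)
    have hadd3 : ∀ a b c c' d, S a b (c + c') d = S a b c d + S a b c' d := by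
      intro a b c c' d
      rw [h34 a b d, h34 a b d, h34 a b d, hpair a b d, hpair a b d c, hpair a b d c', hadd]; ring
    rw [hadd, hadd3, hadd3, hsec, hsec] at e1
    have e2 : S a c b a = S a b c a := by
      rw [hpair, h12, h34]; ring
    linarith
  -- Polarising in the outer slots makes `S` skew there too. It is then totally skew, so that the
  -- cyclic identity reads `3 S = 0`.
  have h1 : ∀ a b c d, S a b c d = -S d b c a := by
    intro a b c d
    have hadd1 : ∀ a a' b c d, S (a + a') b c d = S a b c d + S a' b c d := by
      intro a a' b c d
      rw [h12 b, h12 b, h12 b, hadd]; ring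
    have hadd4 : ∀ a b c d d', S a b c (d + d') = S a b c d + S a b c d' := by
      intro a b c d d'
      rw [hpair, hadd, hpair c d, hpair c d']
    have e := h0 (a + d) b c
    rw [hadd1, hadd4, hadd4, h0, h0] at e
    linarith
  have e1 := h1 u v w z
  have e2 := h1 v u w z
  have e3 := h1 v w u z
  have e4 := hcyc u v w z
  have e5 := hcyc z v w u
  have e6 := h12 u v w z
  have e7 := h12 z v w u
  have e8 := hpair z v w u
  have e9 := h12 w u z v
  have e10 := h34 u w z v
  have e11 := h1 w u v z
  have e12 := h12 z w u v
  have e13 := hpair v z w u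
  have e14 := hpair w z u v
  have e15 := h34 u v z w
  have e16 := h12 u v w z
  have e17 := h12 w z u v
  have e18 := h34 w u v z
  have e19 := hpair w u z v
  linarith

end LocalMetric

section LocalLift

/-! ### The natural tensor field on the cotangent bundle of an open set -/

variable {E : Type*} [NormedAddCommGroup E] [NormedSpace ℝ E]

/-- The curvature endomorphism `R(u, v)`. -/
def modelCurvatureEnd (Γ : E → E →L[ℝ] E →L[ℝ] E) (y u v : E) : E →L[ℝ] E :=
  fderiv ℝ Γ y u v - fderiv ℝ Γ y v u + (Γ y u).comp (Γ y v) - (Γ y v).comp (Γ y u)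

/-- The covector-valued form `u ↦ p ∘ Γ(u, ·)`. -/
def modelGamma (Γ : E → E →L[ℝ] E →L[ℝ] E) (z : E × (E →L[ℝ] ℝ)) : E →L[ℝ] (E →L[ℝ] ℝ) :=
  (ContinuousLinearMap.compL ℝ E E ℝ z.2).comp (Γ z.1)

/-- The horizontal lift on the cotangent bundle of an open set. -/
def modelHorizontal (Γ : E → E →L[ℝ] E →L[ℝ] E) (z : E × (E →L[ℝ] ℝ)) :
    E →L[ℝ] E × (E →L[ℝ] ℝ) :=
  (ContinuousLinearMap.id ℝ E).prod (modelGamma Γ z)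

/-- The vertical part of a tangent vector of the cotangent bundle of an open set. -/
def modelVerticalPart (Γ : E → E →L[ℝ] E →L[ℝ] E) (z : E × (E →L[ℝ] ℝ)) :
    E × (E →L[ℝ] ℝ) →L[ℝ] (E →L[ℝ] ℝ) :=
  ContinuousLinearMap.snd ℝ E (E →L[ℝ] ℝ) -
    (modelGamma Γ z).comp (ContinuousLinearMap.fst ℝ E (E →L[ℝ] ℝ))

/-- The energy density on the cotangent bundle of an open set. -/
def modelEnergy (G : E → E →L[ℝ] E →L[ℝ] ℝ) (z : E × (E →L[ℝ] ℝ)) : ℝ :=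
  (1 / 2 : ℝ) * z.2 ((G z.1).inverse z.2)

/-- The map `u ↦ a g_u + b p(u) p`. -/
def flatPart (a b : ℝ → ℝ) (G : E → E →L[ℝ] E →L[ℝ] ℝ) (z : E × (E →L[ℝ] ℝ)) :
    E →L[ℝ] (E →L[ℝ] ℝ) :=
  a (modelEnergy G z) • G z.1 + b (modelEnergy G z) • z.2.smulRight z.2

/-- The map `θ ↦ a θ^♯ + b g⁻¹(p, θ) p^♯`. -/
def sharpPart (a b : ℝ → ℝ) (G : E → E →L[ℝ] E →L[ℝ] ℝ) (z : E × (E →L[ℝ] ℝ)) :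
    (E →L[ℝ] ℝ) →L[ℝ] E :=
  a (modelEnergy G z) • (G z.1).inverse +
    b (modelEnergy G z) • (z.2.comp (G z.1).inverse).smulRight ((G z.1).inverse z.2)

/-- The natural tensor field of diagonal type on the cotangent bundle of an open set. -/
def modelJ (a₁ a₂ b₁ b₂ : ℝ → ℝ) (G : E → E →L[ℝ] E →L[ℝ] ℝ) (z : E × (E →L[ℝ] ℝ)) :
    E × (E →L[ℝ] ℝ) →L[ℝ] E × (E →L[ℝ] ℝ) :=
  (ContinuousLinearMap.inr ℝ E (E →L[ℝ] ℝ)).comp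
      ((flatPart a₁ b₁ G z).comp (ContinuousLinearMap.fst ℝ E (E →L[ℝ] ℝ))) -
    (modelHorizontal (modelChristoffel G) z).comp
      ((sharpPart a₂ b₂ G z).comp (modelVerticalPart (modelChristoffel G) z))

variable {G : E → E →L[ℝ] E →L[ℝ] ℝ} {s : Set E} {z : E × (E →L[ℝ] ℝ)}
  {a₁ a₂ b₁ b₂ : ℝ → ℝ}

@[simp] theorem modelGamma_apply (Γ : E → E →L[ℝ] E →L[ℝ] E) (z : E × (E →L[ℝ] ℝ)) (u : E) :
    modelGamma Γ z u = z.2.comp (Γ z.1 u) := rfl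

theorem modelHorizontal_apply (Γ : E → E →L[ℝ] E →L[ℝ] E) (z : E × (E →L[ℝ] ℝ)) (u : E) :
    modelHorizontal Γ z u = (u, z.2.comp (Γ z.1 u)) := rfl

theorem modelVerticalPart_horizontal (Γ : E → E →L[ℝ] E →L[ℝ] E) (z : E × (E →L[ℝ] ℝ)) (u : E) :
    modelVerticalPart Γ z (modelHorizontal Γ z u) = 0 := by
  simp [modelVerticalPart, modelHorizontal]

theorem modelJ_horizontal (z : E × (E →L[ℝ] ℝ)) (u : E) :
    modelJ a₁ a₂ b₁ b₂ G z (modelHorizontal (modelChristoffel G) z u) =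
      (0, flatPart a₁ b₁ G z u) := by
  simp only [modelJ, sub_apply, ContinuousLinearMap.comp_apply, modelVerticalPart_horizontal,
    map_zero, sub_zero]
  rfl

theorem modelJ_vertical (z : E × (E →L[ℝ] ℝ)) (θ : E →L[ℝ] ℝ) :
    modelJ a₁ a₂ b₁ b₂ G z (0, θ) =
      -modelHorizontal (modelChristoffel G) z (sharpPart a₂ b₂ G z θ) := by
  simp [modelJ, modelVerticalPart]

/-- Every tangent vector is the sum of a horizontal one and of the image of a horizontal one. -/
theorem exists_horizontal_add_modelJ (hJJ : ∀ v, modelJ a₁ a₂ b₁ b₂ G z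
      (modelJ a₁ a₂ b₁ b₂ G z v) = -v) (w : E × (E →L[ℝ] ℝ)) :
    ∃ u ∈ range (modelHorizontal (modelChristoffel G) z),
      ∃ v ∈ range (modelHorizontal (modelChristoffel G) z), w = u + modelJ a₁ a₂ b₁ b₂ G z v := by
  -- For vertical `(0, η)`, `J (0, η)` is minus the lift of `sharpPart η`; applying `J` again and
  -- using `J² = -1` shows that `J` sends this lift to `(0, η)`.
  refine ⟨_, ⟨w.1, rfl⟩, modelHorizontal (modelChristoffel G) z (sharpPart a₂ b₂ G z
    (w.2 - modelGamma (modelChristoffel G) z w.1)), ⟨_, rfl⟩, ?_⟩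
  have h := hJJ (0, w.2 - modelGamma (modelChristoffel G) z w.1)
  rw [modelJ_vertical, map_neg, neg_inj] at h
  rw [h, modelHorizontal_apply]
  ext <;> simp

/-- The vector `u` is constant in the coordinates, so only `p` and `Γ` are differentiated. Here and
below the derivative is recorded by its values on pairs `(w, η)`. -/
theorem hasFDerivAt_modelHorizontal {Γ : E → E →L[ℝ] E →L[ℝ] E}
    (hΓ : DifferentiableAt ℝ Γ z.1) (u : E) :
    ∃ L : E × (E →L[ℝ] ℝ) →L[ℝ] E × (E →L[ℝ] ℝ),
      HasFDerivAt (fun z => modelHorizontal Γ z u) L z ∧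
      ∀ w η, L (w, η) = (0, η.comp (Γ z.1 u) + z.2.comp (fderiv ℝ Γ z.1 w u)) := by
  have h1 : HasFDerivAt (fun z : E × (E →L[ℝ] ℝ) => z.1) (ContinuousLinearMap.fst ℝ _ _) z :=
    hasFDerivAt_fst
  have h2 : HasFDerivAt (fun z : E × (E →L[ℝ] ℝ) => z.2) (ContinuousLinearMap.snd ℝ _ _) z :=
    hasFDerivAt_snd
  have h3 := (hΓ.hasFDerivAt.comp z h1).clm_apply (hasFDerivAt_const u z)
  refine ⟨_, (hasFDerivAt_const u z).prodMk (h2.clm_comp h3), fun w η => ?_⟩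
  ext <;> simp [add_comm]

theorem IsMetricOn.energy_nonneg [FiniteDimensional ℝ E] (hG : IsMetricOn G s) (hz : z.1 ∈ s) :
    0 ≤ modelEnergy G z :=
  half_apply_inverse_nonneg (hG.pos _ hz) z.2

theorem IsMetricOn.apply_inverse_apply [FiniteDimensional ℝ E] (hG : IsMetricOn G s) {y : E}
    (hy : y ∈ s) (θ η : E →L[ℝ] ℝ) : θ ((G y).inverse η) = η ((G y).inverse θ) := by
  conv_lhs => rw [← hG.apply_inverse hy θ]
  conv_rhs => rw [← hG.apply_inverse hy η]
  rw [hG.symm y hy]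

theorem IsMetricOn.hasFDerivAt_energy [FiniteDimensional ℝ E] (hG : IsMetricOn G s)
    (hz : z.1 ∈ s) : ∃ L : E × (E →L[ℝ] ℝ) →L[ℝ] ℝ, HasFDerivAt (modelEnergy G) L z ∧
      ∀ w η, L (w, η) = η ((G z.1).inverse z.2) -
        (1 / 2 : ℝ) * fderiv ℝ G z.1 w ((G z.1).inverse z.2) ((G z.1).inverse z.2) := by
  have h1 : HasFDerivAt (fun z : E × (E →L[ℝ] ℝ) => z.1) (ContinuousLinearMap.fst ℝ _ _) z :=
    hasFDerivAt_fst
  have h2 : HasFDerivAt (fun z : E × (E →L[ℝ] ℝ) => z.2) (ContinuousLinearMap.snd ℝ _ _) z :=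
    hasFDerivAt_snd
  have hGd := (hG.differentiableAt hz).hasFDerivAt
  have hI := ((hG.contDiffAt_inverse hz).differentiableAt (by simp)).hasFDerivAt
  set I := fun y => (G y).inverse with hIdef
  -- Differentiate `G (G⁻¹ θ) = θ`.
  have key : ∀ w θ, fderiv ℝ I z.1 w θ = -I z.1 (fderiv ℝ G z.1 w (I z.1 θ)) := by
    intro w θ
    have hc : (fun y => G y (I y θ)) =ᶠ[𝓝 z.1] fun _ => θ :=
      Filter.eventually_of_mem (hG.isOpen.mem_nhds hz) fun y hy => hG.apply_inverse hy θ
    have e := (hGd.clm_apply (hI.clm_apply (hasFDerivAt_const θ z.1))).unique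
      ((hasFDerivAt_const θ z.1).congr_of_eventuallyEq hc)
    have e' := congrArg (fun L : E →L[ℝ] E →L[ℝ] ℝ => L w) e
    simp at e'
    refine hG.injective hz ?_
    rw [map_neg]
    simp only [I, hG.apply_inverse hz]
    exact eq_neg_of_add_eq_zero_left e'
  have h3 := h2.clm_apply ((hI.comp z h1).clm_apply h2)
  refine ⟨_, h3.const_mul (1 / 2 : ℝ), fun w η => ?_⟩
  have e1 := hG.apply_inverse_apply hz z.2 η
  have e2 := hG.apply_inverse_apply hz z.2
    (fderiv ℝ G z.1 w ((G z.1).inverse z.2))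
  simp [key, I] at *
  rw [e1, e2]
  ring

/-- On the zero section the energy sits at the endpoint `0`, where `a` has only a one-sided
derivative. As the energy is nonnegative over all of `s`, the chain rule within `[0, ∞)` still
yields a full derivative. -/
theorem IsMetricOn.hasFDerivAt_comp_energy [FiniteDimensional ℝ E] (hG : IsMetricOn G s)
    (hz : z.1 ∈ s) {a : ℝ → ℝ} (ha : ContDiffOn ℝ ∞ a (Ici 0)) :
    ∃ L : E × (E →L[ℝ] ℝ) →L[ℝ] ℝ, HasFDerivAt (fun z => a (modelEnergy G z)) L z ∧
      ∀ w η, L (w, η) = derivWithin a (Ici 0) (modelEnergy G z) * (η ((G z.1).inverse z.2) -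
        (1 / 2 : ℝ) * fderiv ℝ G z.1 w ((G z.1).inverse z.2) ((G z.1).inverse z.2)) := by
  obtain ⟨L, hL, hLe⟩ := hG.hasFDerivAt_energy hz
  have h1 := ((ha.differentiableOn (by simp)) _
    (mem_Ici.2 (hG.energy_nonneg hz))).hasDerivWithinAt
  have hs : s ×ˢ (univ : Set (E →L[ℝ] ℝ)) ∈ 𝓝 z :=
    (hG.isOpen.prod isOpen_univ).mem_nhds ⟨hz, mem_univ _⟩
  have h2 := (h1.hasFDerivWithinAt.comp z hL.hasFDerivWithinAt
    (fun z' (hz' : z' ∈ s ×ˢ univ) => mem_Ici.2 (hG.energy_nonneg hz'.1))).hasFDerivAt hs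
  refine ⟨_, h2, fun w η => ?_⟩
  simp [hLe, mul_comm]

end LocalLift

/-! ### The Nijenhuis tensor of the local model on horizontal vectors -/

section LocalNijenhuis

open VectorField

variable {E : Type*} [NormedAddCommGroup E] [NormedSpace ℝ E] [FiniteDimensional ℝ E]
  {G : E → E →L[ℝ] E →L[ℝ] ℝ} {s : Set E} {z : E × (E →L[ℝ] ℝ)} {a₁ a₂ b₁ b₂ : ℝ → ℝ}

namespace IsMetricOn

theorem differentiableAt_comp_energy (hG : IsMetricOn G s)
    (hz : z.1 ∈ s) {a : ℝ → ℝ} (ha : ContDiffOn ℝ ∞ a (Ici 0)) :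
    DifferentiableAt ℝ (fun z => a (modelEnergy G z)) z :=
  let ⟨_, h, _⟩ := hG.hasFDerivAt_comp_energy hz ha
  h.differentiableAt

theorem differentiableAt_modelJ (hG : IsMetricOn G s) (hz : z.1 ∈ s)
    (ha₁ : ContDiffOn ℝ ∞ a₁ (Ici 0)) (ha₂ : ContDiffOn ℝ ∞ a₂ (Ici 0))
    (hb₁ : ContDiffOn ℝ ∞ b₁ (Ici 0)) (hb₂ : ContDiffOn ℝ ∞ b₂ (Ici 0)) :
    DifferentiableAt ℝ (modelJ a₁ a₂ b₁ b₂ G) z := by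
  have d1 := hG.differentiableAt_comp_energy hz ha₁
  have d2 := hG.differentiableAt_comp_energy hz ha₂
  have d3 := hG.differentiableAt_comp_energy hz hb₁
  have d4 := hG.differentiableAt_comp_energy hz hb₂
  have h1 : DifferentiableAt ℝ (fun z : E × (E →L[ℝ] ℝ) => z.1) z := differentiableAt_fst
  have h2 : DifferentiableAt ℝ (fun z : E × (E →L[ℝ] ℝ) => z.2) z := differentiableAt_snd
  have hGd : DifferentiableAt ℝ (fun z : E × (E →L[ℝ] ℝ) => G z.1) z :=
    (hG.differentiableAt hz).comp z h1
  have hI : DifferentiableAt ℝ (fun z : E × (E →L[ℝ] ℝ) => (G z.1).inverse) z :=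
    ((hG.contDiffAt_inverse hz).differentiableAt (by simp)).comp z h1
  have hΓ : DifferentiableAt ℝ (fun z : E × (E →L[ℝ] ℝ) => modelChristoffel G z.1) z :=
    (hG.differentiableAt_christoffel hz).comp z h1
  have hγ : DifferentiableAt ℝ (modelGamma (modelChristoffel G)) z :=
    ((ContinuousLinearMap.compL ℝ E E ℝ).differentiableAt.comp z h2).clm_comp hΓ
  have hflat : DifferentiableAt ℝ (flatPart a₁ b₁ G) z := by
    have e : DifferentiableAt ℝ (fun z : E × (E →L[ℝ] ℝ) => z.2.smulRight z.2) z := by fun_prop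
    exact (d1.smul hGd).add (d3.smul e)
  have hsharp : DifferentiableAt ℝ (sharpPart a₂ b₂ G) z := by
    have e : DifferentiableAt ℝ (fun z : E × (E →L[ℝ] ℝ) =>
        (z.2.comp (G z.1).inverse).smulRight ((G z.1).inverse z.2)) z := by fun_prop
    exact (d2.smul hI).add (d4.smul e)
  have hhor : DifferentiableAt ℝ (modelHorizontal (modelChristoffel G)) z := by
    have e : modelHorizontal (modelChristoffel G) = fun z =>
        (ContinuousLinearMap.inl ℝ E (E →L[ℝ] ℝ)) +
          (ContinuousLinearMap.inr ℝ E (E →L[ℝ] ℝ)).comp (modelGamma (modelChristoffel G) z) := by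
      funext z; ext <;> simp [modelHorizontal_apply]
    rw [e]
    exact (differentiableAt_const _).add ((differentiableAt_const _).clm_comp hγ)
  have hver : DifferentiableAt ℝ (modelVerticalPart (modelChristoffel G)) z :=
    (differentiableAt_const _).sub (hγ.clm_comp (differentiableAt_const _))
  exact ((differentiableAt_const _).clm_comp (hflat.clm_comp (differentiableAt_const _))).sub
    (hhor.clm_comp (hsharp.clm_comp hver))

theorem hasFDerivAt_flatPart (hG : IsMetricOn G s) (hz : z.1 ∈ s) {a b : ℝ → ℝ}
    (ha : ContDiffOn ℝ ∞ a (Ici 0)) (hb : ContDiffOn ℝ ∞ b (Ici 0)) (u : E) :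
    ∃ L : E × (E →L[ℝ] ℝ) →L[ℝ] (E →L[ℝ] ℝ),
      HasFDerivAt (fun z => flatPart a b G z u) L z ∧
      ∀ w η, L (w, η) =
        (let τ := η ((G z.1).inverse z.2) -
          (1 / 2 : ℝ) * fderiv ℝ G z.1 w ((G z.1).inverse z.2) ((G z.1).inverse z.2)
        (derivWithin a (Ici 0) (modelEnergy G z) * τ) • G z.1 u +
          a (modelEnergy G z) • fderiv ℝ G z.1 w u +
          (derivWithin b (Ici 0) (modelEnergy G z) * τ * z.2 u) • z.2 +
          b (modelEnergy G z) • (η u • z.2 + z.2 u • η)) := by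
  obtain ⟨A, hA, hAe⟩ := hG.hasFDerivAt_comp_energy hz ha
  obtain ⟨B, hB, hBe⟩ := hG.hasFDerivAt_comp_energy hz hb
  have h1 : HasFDerivAt (fun z : E × (E →L[ℝ] ℝ) => z.1) (ContinuousLinearMap.fst ℝ _ _) z :=
    hasFDerivAt_fst
  have h2 : HasFDerivAt (fun z : E × (E →L[ℝ] ℝ) => z.2) (ContinuousLinearMap.snd ℝ _ _) z :=
    hasFDerivAt_snd
  have hGd := ((hG.differentiableAt hz).hasFDerivAt.comp z h1).clm_apply (hasFDerivAt_const u z)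
  have h3 := (h2.clm_apply (hasFDerivAt_const u z)).smul h2
  refine ⟨_, (hA.smul hGd).add (hB.smul h3), fun w η => ?_⟩
  ext x
  simp [hAe, hBe]
  ring

/-- The Nijenhuis tensor of the natural tensor field on horizontal vectors. -/
theorem nijenhuisTensor_horizontal (hG : IsMetricOn G s) (hz : z.1 ∈ s)
    (ha₁ : ContDiffOn ℝ ∞ a₁ (Ici 0)) (ha₂ : ContDiffOn ℝ ∞ a₂ (Ici 0))
    (hb₁ : ContDiffOn ℝ ∞ b₁ (Ici 0)) (hb₂ : ContDiffOn ℝ ∞ b₂ (Ici 0))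
    (hJJ : ∀ v, modelJ a₁ a₂ b₁ b₂ G z (modelJ a₁ a₂ b₁ b₂ G z v) = -v) (u v : E) :
    nijenhuisTensor (modelJ a₁ a₂ b₁ b₂ G) z (modelHorizontal (modelChristoffel G) z u)
      (modelHorizontal (modelChristoffel G) z v) = (0,
        (let t := modelEnergy G z
        ((a₁ t + 2 * t * b₁ t) * derivWithin a₁ (Ici 0) t - a₁ t * b₁ t) •
          (z.2 u • G z.1 v - z.2 v • G z.1 u)) -
        z.2.comp (modelCurvatureEnd (modelChristoffel G) z.1 u v)) := by
  set Γ := modelChristoffel G with hΓ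
  have hdΓ := hG.differentiableAt_christoffel hz
  -- By tensoriality any extensions of the two vectors may be used; the horizontal lifts of constant
  -- fields are the convenient ones.
  rw [← modelNijenhuis_eq_tensor (hG.differentiableAt_modelJ hz ha₁ ha₂ hb₁ hb₂)
    (X := fun z => modelHorizontal Γ z u) (Y := fun z => modelHorizontal Γ z v)
    (hasFDerivAt_modelHorizontal hdΓ u).choose_spec.1.differentiableAt
    (hasFDerivAt_modelHorizontal hdΓ v).choose_spec.1.differentiableAt hJJ]
  obtain ⟨U, hU, hUe⟩ := hasFDerivAt_modelHorizontal (Γ := Γ) hdΓ u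
  obtain ⟨V, hV, hVe⟩ := hasFDerivAt_modelHorizontal (Γ := Γ) hdΓ v
  obtain ⟨P, hP, hPe⟩ := hG.hasFDerivAt_flatPart hz ha₁ hb₁ u
  obtain ⟨Q, hQ, hQe⟩ := hG.hasFDerivAt_flatPart hz ha₁ hb₁ v
  have hP' := ((hasFDerivAt_const (0 : E) z).prodMk hP).fderiv
  have hQ' := ((hasFDerivAt_const (0 : E) z).prodMk hQ).fderiv
  -- The energy is constant along horizontal directions, since parallel transport preserves the
  -- metric.
  have hcomp : ∀ w : E, z.2 (Γ z.1 w ((G z.1).inverse z.2)) - (1 / 2 : ℝ) *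
      fderiv ℝ G z.1 w ((G z.1).inverse z.2) ((G z.1).inverse z.2) = 0 := by
    intro w
    have e := hG.apply_inverse hz z.2
    rw [hG.fderiv_eq hz, hG.symm _ hz _ ((G z.1).inverse z.2), e]
    ring
  have hsymΓ : Γ z.1 v u = Γ z.1 u v := hG.christoffel_symm hz v u
  have h1 : P (modelHorizontal Γ z v) = (flatPart a₁ b₁ G z u).comp (Γ z.1 v) +
      a₁ (modelEnergy G z) • G z.1 (Γ z.1 u v) +
        (b₁ (modelEnergy G z) * z.2 (Γ z.1 u v)) • z.2 := by
    rw [modelHorizontal_apply, hPe]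
    ext x
    simp only [ContinuousLinearMap.comp_apply, hcomp]
    simp [flatPart, hG.fderiv_eq hz, ← hΓ, hsymΓ]
    ring
  have h2 : Q (modelHorizontal Γ z u) = (flatPart a₁ b₁ G z v).comp (Γ z.1 u) +
      a₁ (modelEnergy G z) • G z.1 (Γ z.1 u v) +
        (b₁ (modelEnergy G z) * z.2 (Γ z.1 u v)) • z.2 := by
    rw [modelHorizontal_apply, hQe]
    ext x
    simp only [ContinuousLinearMap.comp_apply, hcomp]
    simp [flatPart, hG.fderiv_eq hz, ← hΓ]
    ring
  simp only [modelNijenhuis, hΓ, modelJ_horizontal]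
  simp only [← hΓ, lieBracket_eq, hU.fderiv, hV.fderiv, hP', hQ']
  have h3 : (G z.1 u) ((G z.1).inverse z.2) = z.2 u := by
    rw [hG.symm _ hz, hG.apply_inverse hz]
  have h4 : (G z.1 v) ((G z.1).inverse z.2) = z.2 v := by
    rw [hG.symm _ hz, hG.apply_inverse hz]
  have h5 : z.2 ((G z.1).inverse z.2) = 2 * modelEnergy G z := by
    unfold modelEnergy; ring
  -- This is `[JX, Y] = -[X, JY]`: the terms in `Γ(u, v)` of `h1` and `h2` agree, so the two terms
  -- with an outer `J` cancel in `N`.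
  have h7 : V (0, flatPart a₁ b₁ G z u) - (0, P (modelHorizontal Γ z v)) =
      -((0, Q (modelHorizontal Γ z u)) - U (0, flatPart a₁ b₁ G z v)) := by
    rw [hVe, hUe, h1, h2]
    ext x
    · simp
    · simp
      ring
  simp only [ContinuousLinearMap.prod_apply, zero_apply, h7, map_neg]
  rw [modelHorizontal_apply, modelHorizontal_apply, hUe, hUe, hVe, hPe, hQe]
  have hsym := hG.symm z.1 hz v u
  ext x
  · simp
  -- Along `flatPart u` the energy varies at rate `(a₁ + 2 t b₁) p(u)`, which produces the `a₁'`
  -- term. The `b₁'` terms are symmetric in `u`, `v` and drop out, and `[X, Y]` contributes the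
  -- curvature.
  · simp [flatPart, h3, h4, h5, modelCurvatureEnd, hsym]
    ring

end IsMetricOn

end LocalNijenhuis

section CoordinateChange

/-! ### Coordinate changes -/

variable {E : Type*} [NormedAddCommGroup E] [NormedSpace ℝ E] [FiniteDimensional ℝ E]
  {G₀ G₁ : E → E →L[ℝ] E →L[ℝ] ℝ} {s₀ s₁ : Set E} {σ : E → E} {y : E}

/-- The transformation law of the Christoffel symbols under an isometry. -/
theorem fderiv_apply_christoffel (hG₀ : IsMetricOn G₀ s₀) (hG₁ : IsMetricOn G₁ s₁)
    (hy : y ∈ s₁) (hσy : σ y ∈ s₀) (hσ : ContDiffAt ℝ ∞ σ y)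
    (hinv : Function.Surjective (fderiv ℝ σ y))
    (hG : ∀ᶠ y in 𝓝 y, ∀ u v, G₁ y u v = G₀ (σ y) (fderiv ℝ σ y u) (fderiv ℝ σ y v)) (u v : E) :
    fderiv ℝ σ y (modelChristoffel G₁ y u v) = fderiv ℝ (fderiv ℝ σ) y u v +
      modelChristoffel G₀ (σ y) (fderiv ℝ σ y u) (fderiv ℝ σ y v) := by
  have hdσ := (hσ.differentiableAt (by simp)).hasFDerivAt
  have hσ2 : ContDiffAt ℝ ∞ (fderiv ℝ σ) y := hσ.fderiv_right (by simp)
  have hd2 := (hσ2.differentiableAt (by simp)).hasFDerivAt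
  have hsymm : ∀ u v, fderiv ℝ (fderiv ℝ σ) y u v = fderiv ℝ (fderiv ℝ σ) y v u :=
    fun u v => hσ.isSymmSndFDerivAt (n := ∞)
      (by simpa using WithTop.coe_le_coe.2 (le_top : (2 : ℕ∞) ≤ ⊤)) u v
  have h0 := (hG₀.differentiableAt hσy).hasFDerivAt.comp y hdσ
  have h1 := (hG₁.differentiableAt hy).hasFDerivAt
  -- Differentiate `G₁ = σ^* G₀`; the second derivative of `σ` appears once for each argument.
  have key : ∀ w u v, fderiv ℝ G₁ y w u v =
      fderiv ℝ G₀ (σ y) (fderiv ℝ σ y w) (fderiv ℝ σ y u) (fderiv ℝ σ y v) +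
      G₀ (σ y) (fderiv ℝ (fderiv ℝ σ) y w u) (fderiv ℝ σ y v) +
      G₀ (σ y) (fderiv ℝ σ y u) (fderiv ℝ (fderiv ℝ σ) y w v) := by
    intro w u v
    have e0 := (h0.clm_apply (hd2.clm_apply (hasFDerivAt_const u y))).clm_apply
      (hd2.clm_apply (hasFDerivAt_const v y))
    have e1 := (h1.clm_apply (hasFDerivAt_const u y)).clm_apply (hasFDerivAt_const v y)
    have e := e1.unique (e0.congr_of_eventuallyEq (hG.mono fun y h => h u v))
    have e' := congrArg (fun L : E →L[ℝ] ℝ => L w) e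
    simp at e'
    rw [e']; ring
  refine hG₀.injective hσy (ContinuousLinearMap.ext fun w => ?_)
  obtain ⟨x, rfl⟩ := hinv w
  rw [← hG.self_of_nhds, hG₁.apply_christoffel hy, map_add, add_apply,
    hG₀.apply_christoffel hσy, key, key, key, hsymm x u, hsymm x v, hsymm v u,
    hG₀.symm _ hσy (fderiv ℝ σ y v), hG₀.symm _ hσy (fderiv ℝ σ y u)]
  ring

/-- The natural tensor field is invariant under the lift of an isometry to the cotangent bundle. -/
theorem modelJ_transform {a₁ a₂ b₁ b₂ : ℝ → ℝ} (hG₀ : IsMetricOn G₀ s₀) (hG₁ : IsMetricOn G₁ s₁)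
    (hy : y ∈ s₁) (hσy : σ y ∈ s₀) (hσ : ContDiffAt ℝ ∞ σ y)
    (hinv : Function.Surjective (fderiv ℝ σ y))
    (hG : ∀ᶠ y in 𝓝 y, ∀ u v, G₁ y u v = G₀ (σ y) (fderiv ℝ σ y u) (fderiv ℝ σ y v))
    {p q : E →L[ℝ] ℝ} (hpq : p.comp (fderiv ℝ σ y) = q)
    {L : E × (E →L[ℝ] ℝ) →L[ℝ] E × (E →L[ℝ] ℝ)} (hL1 : ∀ w, (L w).1 = fderiv ℝ σ y w.1)
    (hL2 : ∀ w, (L w).2.comp (fderiv ℝ σ y) + p.comp (fderiv ℝ (fderiv ℝ σ) y w.1) = w.2)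
    (w : E × (E →L[ℝ] ℝ)) :
    L (modelJ a₁ a₂ b₁ b₂ G₁ (y, q) w) = modelJ a₁ a₂ b₁ b₂ G₀ (σ y, p) (L w) := by
  have hΓ := fderiv_apply_christoffel hG₀ hG₁ hy hσy hσ hinv hG
  have hGy := hG.self_of_nhds
  set A := fderiv ℝ σ y with hA
  subst hpq
  have hcancel : ∀ η θ : E →L[ℝ] ℝ, η.comp A = θ.comp A → η = θ := by
    intro η θ h
    ext x
    obtain ⟨x, rfl⟩ := hinv x
    exact congrArg (fun L : E →L[ℝ] ℝ => L x) h
  -- The inhomogeneous term in the law for `Γ` is exactly the second derivative of `σ` in `hL2`, so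
  -- horizontal lifts go to horizontal lifts.
  have hLh : ∀ u, L (modelHorizontal (modelChristoffel G₁) (y, p.comp A) u) =
      modelHorizontal (modelChristoffel G₀) (σ y, p) (A u) := by
    intro u
    refine Prod.ext (by rw [hL1]; rfl) (hcancel _ _ ?_)
    have h := hL2 (modelHorizontal (modelChristoffel G₁) (y, p.comp A) u)
    rw [← eq_sub_iff_add_eq] at h
    rw [h]
    ext x
    simp [modelHorizontal_apply, hΓ]
  have hLv : ∀ θ, (L (0, θ)).1 = 0 ∧ (L (0, θ)).2.comp A = θ := by
    intro θ
    refine ⟨by rw [hL1]; simp, ?_⟩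
    have h := hL2 (0, θ)
    simpa using h
  have hsharp : ∀ k : E →L[ℝ] ℝ, A ((G₁ y).inverse (k.comp A)) = (G₀ (σ y)).inverse k := by
    intro k
    refine hG₀.injective hσy (ContinuousLinearMap.ext fun x => ?_)
    obtain ⟨x, rfl⟩ := hinv x
    rw [← hGy, hG₁.apply_inverse hy, hG₀.apply_inverse hσy]
    rfl
  have hen : modelEnergy G₁ (y, p.comp A) = modelEnergy G₀ (σ y, p) := by
    simp only [modelEnergy, ← hsharp]
    simp
  have hflat : ∀ u, (flatPart a₁ b₁ G₀ (σ y, p) (A u)).comp A =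
      flatPart a₁ b₁ G₁ (y, p.comp A) u := by
    intro u
    ext x
    simp [flatPart, hen, hGy]
  have hsharp' : ∀ k, A (sharpPart a₂ b₂ G₁ (y, p.comp A) (k.comp A)) =
      sharpPart a₂ b₂ G₀ (σ y, p) k := by
    intro k
    simp [sharpPart, hen, hsharp]
  have hdec : w = modelHorizontal (modelChristoffel G₁) (y, p.comp A) w.1 +
      (0, modelVerticalPart (modelChristoffel G₁) (y, p.comp A) w) := by
    ext <;> simp [modelHorizontal_apply, modelVerticalPart]
  generalize modelVerticalPart (modelChristoffel G₁) (y, p.comp A) w = θ at hdec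
  rw [hdec, map_add, map_add, map_add, map_add, modelJ_horizontal, hLh, modelJ_horizontal,
    modelJ_vertical, map_neg, hLh]
  have e1 : L (0, flatPart a₁ b₁ G₁ (y, p.comp A) w.1) = (0, flatPart a₁ b₁ G₀ (σ y, p) (A w.1)) :=
    Prod.ext (hLv _).1 (hcancel _ _ ((hLv _).2.trans (hflat _).symm))
  have e2 : L (0, θ) = (0, (L (0, θ)).2) := Prod.ext (hLv _).1 rfl
  rw [e1, e2, modelJ_vertical, ← hsharp', (hLv θ).2]

end CoordinateChange

/-! ### Derivatives of charts as tangent coordinate changes -/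

section ChartDerivative

variable {E : Type*} [NormedAddCommGroup E] [NormedSpace ℝ E] {H : Type*} [TopologicalSpace H]
  {I : ModelWithCorners ℝ E H} {M : Type*} [TopologicalSpace M] [ChartedSpace H M]
  [IsManifold I 1 M]

theorem mfderiv_extChartAt_eq_tangentCoordChange {x y : M} (h : x ∈ (chartAt H y).source) :
    mfderiv I 𝓘(ℝ, E) (extChartAt I y) x = tangentCoordChange I x y x := by
  exact if_pos (mdifferentiableAt_extChartAt h)

end ChartDerivative

section ChartMetric

/-! ### The metric in the charts of `M` -/

variable {E : Type*} [NormedAddCommGroup E] [NormedSpace ℝ E]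
  {M : Type*} [TopologicalSpace M] [ChartedSpace E M]
  [IsManifold 𝓘(ℝ, E) ∞ M] (g : Metric E M)

/-- The metric at `x` as a bilinear form on the model space. -/
def metricAt (x : M) : E →L[ℝ] E →L[ℝ] ℝ := g.inner x

/-- The derivative of the inverse of a chart, as a map of the model space. -/
def chartSymmDeriv (x₀ : M) (y : E) : E →L[ℝ] E :=
  mfderiv 𝓘(ℝ, E) 𝓘(ℝ, E) (extChartAt 𝓘(ℝ, E) x₀).symm y

/-- The change of coordinates from the chart around `x` to the chart around `x₀`. -/
def transition (x₀ x : M) : E → E := extChartAt 𝓘(ℝ, E) x₀ ∘ (extChartAt 𝓘(ℝ, E) x).symm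

theorem metricInChart_apply (x₀ : M) (y u v : E) :
    metricInChart g x₀ y u v = metricAt g ((extChartAt 𝓘(ℝ, E) x₀).symm y)
      (chartSymmDeriv x₀ y u) (chartSymmDeriv x₀ y v) := rfl

theorem chartSymmDeriv_tangentCoordChange {x₀ : M} {y : E}
    (hy : y ∈ (extChartAt 𝓘(ℝ, E) x₀).target) (u : E) :
    chartSymmDeriv x₀ y (tangentCoordChange 𝓘(ℝ, E) ((extChartAt 𝓘(ℝ, E) x₀).symm y) x₀
      ((extChartAt 𝓘(ℝ, E) x₀).symm y) u) = u := by
  have h := mfderivWithin_extChartAt_symm_comp_mfderiv_extChartAt (I := 𝓘(ℝ, E)) hy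
  have hs : (extChartAt 𝓘(ℝ, E) x₀).symm y ∈ (chartAt E x₀).source := by
    rw [← extChartAt_source 𝓘(ℝ, E)]; exact (extChartAt 𝓘(ℝ, E) x₀).map_target hy
  rw [mfderiv_extChartAt_eq_tangentCoordChange hs, modelWithCornersSelf_coe, range_id,
    mfderivWithin_univ] at h
  exact congrArg (fun L : E →L[ℝ] E => L u) h

theorem chartSymmDeriv_injective {x₀ : M} {y : E}
    (hy : y ∈ (extChartAt 𝓘(ℝ, E) x₀).target) : Function.Injective (chartSymmDeriv x₀ y) := by
  have h1 := isInvertible_mfderivWithin_extChartAt_symm (I := 𝓘(ℝ, E)) hy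
  rw [modelWithCornersSelf_coe, range_id, mfderivWithin_univ] at h1
  exact h1.injective

theorem chartSymmDeriv_self (x : M) :
    chartSymmDeriv x (extChartAt 𝓘(ℝ, E) x x) = ContinuousLinearMap.id ℝ E := by
  have h := mfderivWithin_range_extChartAt_symm (I := 𝓘(ℝ, E)) (x := x)
  rw [modelWithCornersSelf_coe, range_id, mfderivWithin_univ] at h
  exact h

theorem metricInChart_self (x : M) :
    metricInChart g x (extChartAt 𝓘(ℝ, E) x x) = metricAt g x := by
  ext u v
  rw [metricInChart_apply, chartSymmDeriv_self, (extChartAt 𝓘(ℝ, E) x).left_inv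
    (mem_extChartAt_source x)]
  rfl

theorem metricInChart_tangentCoordChange {x₀ x : M} (hx : x ∈ (extChartAt 𝓘(ℝ, E) x₀).source)
    (u v : E) :
    metricInChart g x₀ (extChartAt 𝓘(ℝ, E) x₀ x) (tangentCoordChange 𝓘(ℝ, E) x x₀ x u)
      (tangentCoordChange 𝓘(ℝ, E) x x₀ x v) = metricAt g x u v := by
  obtain ⟨y, hy, rfl⟩ : ∃ y ∈ (extChartAt 𝓘(ℝ, E) x₀).target,
      (extChartAt 𝓘(ℝ, E) x₀).symm y = x :=
    ⟨_, (extChartAt 𝓘(ℝ, E) x₀).map_source hx, (extChartAt 𝓘(ℝ, E) x₀).left_inv hx⟩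
  rw [(extChartAt 𝓘(ℝ, E) x₀).right_inv hy, metricInChart_apply,
    chartSymmDeriv_tangentCoordChange hy, chartSymmDeriv_tangentCoordChange hy]

theorem fderiv_transition (x₀ x z : M) :
    fderiv ℝ (transition x₀ x) (extChartAt 𝓘(ℝ, E) x z) =
      tangentCoordChange 𝓘(ℝ, E) x x₀ z := by
  rw [tangentCoordChange_def, modelWithCornersSelf_coe, range_id, fderivWithin_univ]
  rfl

theorem contDiffAt_transition {x₀ x : M} {y : E} (hy : y ∈ (extChartAt 𝓘(ℝ, E) x).target)
    (hy' : (extChartAt 𝓘(ℝ, E) x).symm y ∈ (extChartAt 𝓘(ℝ, E) x₀).source) :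
    ContDiffAt ℝ ∞ (transition x₀ x) y := by
  have h := contDiffWithinAt_ext_coord_change (I := 𝓘(ℝ, E)) (n := ∞) x₀ x (y := y) (by
    rw [PartialEquiv.trans_source, PartialEquiv.symm_source]
    exact ⟨hy, hy'⟩)
  rwa [modelWithCornersSelf_coe, range_id, contDiffWithinAt_univ] at h

theorem surjective_tangentCoordChange {x₀ x z : M} (hx : z ∈ (extChartAt 𝓘(ℝ, E) x).source)
    (hx₀ : z ∈ (extChartAt 𝓘(ℝ, E) x₀).source) :
    Function.Surjective (tangentCoordChange 𝓘(ℝ, E) x x₀ z) := by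
  intro w
  refine ⟨tangentCoordChange 𝓘(ℝ, E) x₀ x z w, ?_⟩
  rw [tangentCoordChange_comp ⟨⟨hx₀, hx⟩, hx₀⟩, tangentCoordChange_self hx₀]

/-- Both sides are `g` at the same point `z`. Writing `u`, `v` in the frame of the chart around `z`
turns the claim into the cocycle rule for coordinate changes. -/
theorem metricInChart_transition {x₀ x : M} {y : E} (hy : y ∈ (extChartAt 𝓘(ℝ, E) x).target)
    (hy' : (extChartAt 𝓘(ℝ, E) x).symm y ∈ (extChartAt 𝓘(ℝ, E) x₀).source) (u v : E) :
    metricInChart g x y u v = metricInChart g x₀ (transition x₀ x y)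
      (fderiv ℝ (transition x₀ x) y u) (fderiv ℝ (transition x₀ x) y v) := by
  obtain ⟨z, hz, rfl⟩ : ∃ z ∈ (extChartAt 𝓘(ℝ, E) x).source, extChartAt 𝓘(ℝ, E) x z = y :=
    ⟨_, (extChartAt 𝓘(ℝ, E) x).map_target hy, (extChartAt 𝓘(ℝ, E) x).right_inv hy⟩
  rw [(extChartAt 𝓘(ℝ, E) x).left_inv hz] at hy'
  have hzz := mem_extChartAt_source (I := 𝓘(ℝ, E)) z
  obtain ⟨u, rfl⟩ := surjective_tangentCoordChange hzz hz u
  obtain ⟨v, rfl⟩ := surjective_tangentCoordChange hzz hz v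
  rw [metricInChart_tangentCoordChange g hz, fderiv_transition,
    tangentCoordChange_comp ⟨⟨hzz, hz⟩, hy'⟩, tangentCoordChange_comp ⟨⟨hzz, hz⟩, hy'⟩,
    transition, Function.comp_apply, (extChartAt 𝓘(ℝ, E) x).left_inv hz,
    metricInChart_tangentCoordChange g hy']

/-- Smoothness comes from reading the section `g` in the trivialisation around `x₀`, which uses the
coordinate frame of the chart. Positivity uses injectivity of the derivative of the inverse chart.
-/
theorem isMetricOn_metricInChart (x₀ : M) :
    IsMetricOn (metricInChart g x₀) (extChartAt 𝓘(ℝ, E) x₀).target where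
  isOpen := isOpen_extChartAt_target x₀
  contDiffOn := by
    have h : ContMDiffOn 𝓘(ℝ, E) 𝓘(ℝ, E →L[ℝ] E →L[ℝ] ℝ) ∞
        (fun x => metricInChart g x₀ (extChartAt 𝓘(ℝ, E) x₀ x)) (chartAt E x₀).source := by
      have h0 := ((trivializationAt (E →L[ℝ] E →L[ℝ] ℝ) (fun x : M =>
        TangentSpace 𝓘(ℝ, E) x →L[ℝ] TangentSpace 𝓘(ℝ, E) x →L[ℝ] ℝ)
        x₀).contMDiffOn_section_iff (chartAt E x₀).open_source (by
          simp)).1 g.contMDiff.contMDiffOn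
      refine h0.congr fun x hx => ?_
      have hx' : x ∈ (extChartAt 𝓘(ℝ, E) x₀).source := by rwa [extChartAt_source]
      have hxx := mem_extChartAt_source (I := 𝓘(ℝ, E)) x
      ext u v
      have e0 : ∀ u, tangentCoordChange 𝓘(ℝ, E) x x₀ x (tangentCoordChange 𝓘(ℝ, E) x₀ x x u) = u :=
        fun u => by
          rw [tangentCoordChange_comp ⟨⟨hx', hxx⟩, hx'⟩, tangentCoordChange_self hx']
      rw [← e0 u, ← e0 v, metricInChart_tangentCoordChange g hx', e0, e0]
      have e1 := inCoordinates_apply_eq₂ (𝕜 := ℝ) (F₁ := E) (F₂ := E) (F₃ := ℝ)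
        (E₁ := fun x : M => TangentSpace 𝓘(ℝ, E) x) (E₂ := fun x : M => TangentSpace 𝓘(ℝ, E) x)
        (E₃ := Bundle.Trivial M ℝ) (x₀ := x₀) (x := x) (ϕ := g.inner x) (v := u) (w := v)
        (by simpa using hx) (by simpa using hx) (by simp)
      have e2 := TangentBundle.symmL_trivializationAt_eq_core (I := 𝓘(ℝ, E)) hx
      have e3 : ∀ u, (trivializationAt E (TangentSpace 𝓘(ℝ, E)) x₀).symm x u =
          tangentCoordChange 𝓘(ℝ, E) x₀ x x u :=
        fun u => (Trivialization.symmL_apply (R := ℝ) _ (by simpa using hx) u).symm.trans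
          (congrArg (fun L : E →L[ℝ] E => L u) e2)
      refine Eq.trans ?_ e1.symm
      rw [e3, e3]
      simp
      rfl
    rw [← contMDiffOn_iff_contDiffOn]
    refine (h.comp (contMDiffOn_extChartAt_symm x₀) fun y hy => ?_).congr fun y hy => ?_
    · rw [← extChartAt_source 𝓘(ℝ, E)]; exact (extChartAt 𝓘(ℝ, E) x₀).map_target hy
    · simp only [Function.comp_apply]
      rw [(extChartAt 𝓘(ℝ, E) x₀).right_inv hy]
  symm y hy u v := g.symm _ _ _
  pos y hy u hu := g.pos _ _ fun h => hu (chartSymmDeriv_injective hy (by rw [map_zero]; exact h))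

end ChartMetric

section CotangentCharts

/-! ### The charts of the cotangent bundle -/

variable {E : Type*} [NormedAddCommGroup E] [NormedSpace ℝ E]
  {M : Type*} [TopologicalSpace M] [ChartedSpace E M]
  [IsManifold 𝓘(ℝ, E) ∞ M] (g : Metric E M)

/-- A cotangent vector as a linear form on the model space. -/
def covectorAt (q : CotangentBundle E M) : E →L[ℝ] ℝ := form q

/-- The tensor field `naturalJ` as a map of the model space. -/
def naturalJAt (a₁ a₂ b₁ b₂ : ℝ → ℝ) (q : CotangentBundle E M) (v : E × (E →L[ℝ] ℝ)) :
    E × (E →L[ℝ] ℝ) :=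
  naturalJ g a₁ a₂ b₁ b₂ q v

theorem range_cotangentModel : range (cotangentModel E) = univ := by
  simp [cotangentModel, modelWithCorners_prod_coe]

theorem mem_cotangentChart_source {p q : CotangentBundle E M} :
    q ∈ (extChartAt (cotangentModel E) p).source ↔ q.1 ∈ (extChartAt 𝓘(ℝ, E) p.1).source := by
  rw [FiberBundle.extChartAt]
  simp only [PartialEquiv.trans_source, PartialEquiv.prod_source, mfld_simps]
  exact ⟨fun h => h.1.1, fun h => ⟨⟨h, mem_univ _⟩, h⟩⟩

/-- The trivialisation of the Hom bundle precomposes with the coordinate change from the frame of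
`p.1` to that of `q.1`; the trivial factor `ℝ` contributes the identity. -/
theorem cotangentChart_apply {p q : CotangentBundle E M}
    (h : q.1 ∈ (extChartAt 𝓘(ℝ, E) p.1).source) :
    extChartAt (cotangentModel E) p q = (extChartAt 𝓘(ℝ, E) p.1 q.1,
      (covectorAt q).comp
        (tangentCoordChange 𝓘(ℝ, E) p.1 q.1 q.1)) := by
  rw [FiberBundle.extChartAt]
  refine Prod.ext rfl ?_
  have e2 := TangentBundle.symmL_trivializationAt_eq_core (I := 𝓘(ℝ, E)) (b₀ := p.1) (b := q.1)
    (by rwa [← extChartAt_source 𝓘(ℝ, E)])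
  have e3 : Trivialization.continuousLinearMapAt ℝ (trivializationAt ℝ (Bundle.Trivial M ℝ) p.1) q.1
    = ContinuousLinearMap.id ℝ ℝ := by
    ext
    simp
  have e4 : ((trivializationAt (E →L[ℝ] ℝ) (fun x : M => TangentSpace 𝓘(ℝ, E) x →L[ℝ]
      Bundle.Trivial M ℝ x) p.1) q).2 = (Trivialization.continuousLinearMapAt ℝ
        (trivializationAt ℝ (Bundle.Trivial M ℝ) p.1) q.1).comp
        (ContinuousLinearMap.comp (form q) (Trivialization.symmL ℝ
          (trivializationAt E (TangentSpace 𝓘(ℝ, E)) p.1) q.1)) := rfl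
  refine Eq.trans e4 ?_
  rw [e3, e2]
  rfl

theorem cotangentChart_self (q : CotangentBundle E M) : extChartAt (cotangentModel E) q q =
    (extChartAt 𝓘(ℝ, E) q.1 q.1, covectorAt q) := by
  have hqq := mem_extChartAt_source (I := 𝓘(ℝ, E)) q.1
  rw [cotangentChart_apply hqq]
  refine Prod.ext rfl ?_
  ext x
  simp only [ContinuousLinearMap.comp_apply]
  rw [tangentCoordChange_self hqq]

/-- In the coordinates of the chart around `π(q)`, the tensor field `naturalJ` is `modelJ`. -/
theorem naturalJ_eq_modelJ (a₁ a₂ b₁ b₂ : ℝ → ℝ) (q : CotangentBundle E M)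
    (v : E × (E →L[ℝ] ℝ)) :
    naturalJAt g a₁ a₂ b₁ b₂ q v = modelJ a₁ a₂ b₁ b₂ (metricInChart g q.1)
      (extChartAt 𝓘(ℝ, E) q.1 q.1, covectorAt q) v := by
  have h := metricInChart_self g q.1
  have ht : modelEnergy (metricInChart g q.1) (extChartAt 𝓘(ℝ, E) q.1 q.1, covectorAt q) =
      energy g q := by
    simp only [modelEnergy]
    rw [h]
    rfl
  set z : E × (E →L[ℝ] ℝ) := (extChartAt 𝓘(ℝ, E) q.1 q.1, covectorAt q) with hz
  have e1 : flatPart a₁ b₁ (metricInChart g q.1) z v.1 =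
      a₁ (energy g q) • metricAt g q.1 v.1 + (b₁ (energy g q) * z.2 v.1) • z.2 := by
    simp only [flatPart, ht, add_apply, smul_apply,
      ContinuousLinearMap.smulRight_apply, mul_smul]
    rw [hz, h]
  have e2 : ∀ θ, sharpPart a₂ b₂ (metricInChart g q.1) z θ =
      a₂ (energy g q) • (metricAt g q.1).inverse θ +
        (b₂ (energy g q) * z.2 ((metricAt g q.1).inverse θ)) • (metricAt g q.1).inverse z.2 := by
    intro θ
    simp only [sharpPart, ht, add_apply, smul_apply,
      ContinuousLinearMap.smulRight_apply, mul_smul, ContinuousLinearMap.comp_apply]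
    rw [hz, h]
  have e3 : naturalJAt g a₁ a₂ b₁ b₂ q v =
      (a₁ (energy g q) • ((0, metricAt g q.1 v.1) : E × (E →L[ℝ] ℝ)) +
        (b₁ (energy g q) * z.2 v.1) • ((0, z.2) : E × (E →L[ℝ] ℝ))) +
      (-(a₂ (energy g q) • modelHorizontal (christoffel g q.1) z ((metricAt g q.1).inverse
          (modelVerticalPart (christoffel g q.1) z v))) -
        (b₂ (energy g q) * z.2 ((metricAt g q.1).inverse
          (modelVerticalPart (christoffel g q.1) z v))) •
          modelHorizontal (christoffel g q.1) z ((metricAt g q.1).inverse z.2)) := rfl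
  have e4 : christoffel g q.1 = modelChristoffel (metricInChart g q.1) := rfl
  rw [e3, e4]
  simp only [modelJ, sub_apply, ContinuousLinearMap.comp_apply, ContinuousLinearMap.inr_apply,
    ContinuousLinearMap.coe_fst', e1, e2, map_add, map_smul]
  ext
  · simp; abel
  · simp; ring

/-- The coordinate change from the chart around `q` to the chart around `p`. -/
def cotangentTransition (p q : CotangentBundle E M) : E × (E →L[ℝ] ℝ) → E × (E →L[ℝ] ℝ) :=
  extChartAt (cotangentModel E) p ∘ (extChartAt (cotangentModel E) q).symm

/-- The fibre component is characterised implicitly, without inverting the derivative of the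
transition, and on a neighbourhood, so that the relation can be differentiated. -/
theorem cotangentTransition_spec {p q : CotangentBundle E M}
    (h : q.1 ∈ (extChartAt 𝓘(ℝ, E) p.1).source) :
    ∀ᶠ z in 𝓝 (extChartAt (cotangentModel E) q q),
      (cotangentTransition p q z).1 = transition p.1 q.1 z.1 ∧
      (cotangentTransition p q z).2.comp (fderiv ℝ (transition p.1 q.1) z.1) = z.2 := by
  have h1 : (extChartAt (cotangentModel E) q).target ∈ 𝓝 (extChartAt (cotangentModel E) q q) := by
    have := extChartAt_target_mem_nhdsWithin (I := cotangentModel E) q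
    rwa [range_cotangentModel, nhdsWithin_univ] at this
  have h2 : (extChartAt (cotangentModel E) q).symm ⁻¹' (extChartAt (cotangentModel E) p).source ∈
      𝓝 (extChartAt (cotangentModel E) q q) := by
    refine (continuousAt_extChartAt_symm (I := cotangentModel E) q).preimage_mem_nhds ?_
    rw [extChartAt_to_inv]
    exact (isOpen_extChartAt_source p).mem_nhds (mem_cotangentChart_source.2 h)
  filter_upwards [h1, h2] with z hz hz'
  obtain ⟨r, hr, rfl⟩ : ∃ r ∈ (extChartAt (cotangentModel E) q).source,
      extChartAt (cotangentModel E) q r = z :=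
    ⟨_, (extChartAt (cotangentModel E) q).map_target hz,
      (extChartAt (cotangentModel E) q).right_inv hz⟩
  rw [mem_preimage, (extChartAt (cotangentModel E) q).left_inv hr] at hz'
  have hr1 := mem_cotangentChart_source.1 hr
  have hr2 := mem_cotangentChart_source.1 hz'
  have e : cotangentTransition p q (extChartAt (cotangentModel E) q r) =
      extChartAt (cotangentModel E) p r := by
    rw [cotangentTransition, Function.comp_apply, (extChartAt (cotangentModel E) q).left_inv hr]
  rw [e, cotangentChart_apply hr1, cotangentChart_apply hr2]
  refine ⟨?_, ?_⟩
  · simp only [transition, Function.comp_apply]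
    rw [(extChartAt 𝓘(ℝ, E) q.1).left_inv hr1]
  · simp only [fderiv_transition]
    ext x
    simp only [ContinuousLinearMap.comp_apply]
    rw [tangentCoordChange_comp ⟨⟨hr1, hr2⟩, mem_extChartAt_source _⟩]

/-- The derivative at `q` of the chart around `p`. -/
def cotangentChartDeriv (p q : CotangentBundle E M) : E × (E →L[ℝ] ℝ) →L[ℝ] E × (E →L[ℝ] ℝ) :=
  tangentCoordChange (cotangentModel E) q p q

theorem hasFDerivAt_cotangentTransition {p q : CotangentBundle E M}
    (h : q.1 ∈ (extChartAt 𝓘(ℝ, E) p.1).source) :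
    HasFDerivAt (cotangentTransition p q) (cotangentChartDeriv p q)
      (extChartAt (cotangentModel E) q q) := by
  have := hasFDerivWithinAt_tangentCoordChange (I := cotangentModel E) (x := q) (y := p) (z := q)
    ⟨mem_extChartAt_source q, mem_cotangentChart_source.2 h⟩
  rwa [range_cotangentModel, hasFDerivWithinAt_univ] at this

variable [FiniteDimensional ℝ E]

/-- In the chart around `p`, the tensor field `naturalJ` is `modelJ`. -/
theorem cotangentChartDeriv_naturalJ (a₁ a₂ b₁ b₂ : ℝ → ℝ) {p q : CotangentBundle E M}
    (h : q.1 ∈ (extChartAt 𝓘(ℝ, E) p.1).source) (v : E × (E →L[ℝ] ℝ)) :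
    cotangentChartDeriv p q (naturalJAt g a₁ a₂ b₁ b₂ q v) =
      modelJ a₁ a₂ b₁ b₂ (metricInChart g p.1) (extChartAt (cotangentModel E) p q)
        (cotangentChartDeriv p q v) := by
  have hqq := mem_extChartAt_source (I := 𝓘(ℝ, E)) q.1
  set y := extChartAt 𝓘(ℝ, E) q.1 q.1 with hy
  have hyt : y ∈ (extChartAt 𝓘(ℝ, E) q.1).target := mem_extChartAt_target q.1
  have hsy : (extChartAt 𝓘(ℝ, E) q.1).symm y = q.1 := extChartAt_to_inv q.1
  have hσ := contDiffAt_transition (x₀ := p.1) hyt (by rwa [hsy])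
  have hσy : transition p.1 q.1 y = extChartAt 𝓘(ℝ, E) p.1 q.1 := by
    rw [transition, Function.comp_apply, hsy]
  have hd := hasFDerivAt_cotangentTransition h
  have hspec := cotangentTransition_spec h
  have hqc : extChartAt (cotangentModel E) q q = (y, covectorAt q) := cotangentChart_self q
  have hpc : extChartAt (cotangentModel E) p q =
      (transition p.1 q.1 y, (extChartAt (cotangentModel E) p q).2) := by
    refine Prod.ext ?_ rfl
    rw [cotangentChart_apply h, hσy]
  have hΦ : cotangentTransition p q (y, covectorAt q) = extChartAt (cotangentModel E) p q := by
    rw [← hqc, cotangentTransition, Function.comp_apply, extChartAt_to_inv]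
  rw [hqc] at hd hspec
  have hσ2 : ContDiffAt ℝ ∞ (fderiv ℝ (transition p.1 q.1)) y := hσ.fderiv_right (by simp)
  have hfst : HasFDerivAt (fun z : E × (E →L[ℝ] ℝ) => z.1) (ContinuousLinearMap.fst ℝ _ _)
    (y, covectorAt q) := hasFDerivAt_fst
  have hsnd : HasFDerivAt (fun z : E × (E →L[ℝ] ℝ) => z.2) (ContinuousLinearMap.snd ℝ _ _)
    (y, covectorAt q) := hasFDerivAt_snd
  have hdσ := HasFDerivAt.comp (g := transition p.1 q.1) (y, covectorAt q)
    (hσ.differentiableAt (by simp)).hasFDerivAt hfst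
  have hd2 := HasFDerivAt.comp (g := fderiv ℝ (transition p.1 q.1)) (y, covectorAt q)
    (hσ2.differentiableAt (by simp)).hasFDerivAt hfst
  -- Differentiating the two relations of `hspec` gives the hypotheses `hL1` and `hL2` of
  -- `modelJ_transform`.
  have e1 := hd.fst.unique (hdσ.congr_of_eventuallyEq (hspec.mono fun z hz => hz.1))
  have e2 := (hd.snd.clm_comp hd2).unique
    (hsnd.congr_of_eventuallyEq (hspec.mono fun z hz => hz.2))
  rw [naturalJ_eq_modelJ, hpc]
  refine modelJ_transform (isMetricOn_metricInChart g p.1) (isMetricOn_metricInChart g q.1)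
    hyt ?_ hσ ?_ ?_ ?_ (fun w => ?_) (fun w => ?_) v
  · rw [hσy]; exact (extChartAt 𝓘(ℝ, E) p.1).map_source h
  · rw [hy, fderiv_transition]; exact surjective_tangentCoordChange hqq h
  · have h1 : (extChartAt 𝓘(ℝ, E) q.1).target ∈ 𝓝 y := (isOpen_extChartAt_target q.1).mem_nhds hyt
    have h2 : (extChartAt 𝓘(ℝ, E) q.1).symm ⁻¹' (extChartAt 𝓘(ℝ, E) p.1).source ∈ 𝓝 y := by
      refine (continuousAt_extChartAt_symm (I := 𝓘(ℝ, E)) q.1).preimage_mem_nhds ?_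
      rw [extChartAt_to_inv]
      exact (isOpen_extChartAt_source p.1).mem_nhds h
    filter_upwards [h1, h2] with y' hy1 hy2 u v
    exact metricInChart_transition g hy1 hy2 u v
  · rw [← hΦ]; exact hspec.self_of_nhds.2
  · exact congrArg (fun L : E × (E →L[ℝ] ℝ) →L[ℝ] E => L w) e1
  · have e3 := congrArg (fun L : E × (E →L[ℝ] ℝ) →L[ℝ] (E →L[ℝ] ℝ) => L w) e2
    ext x
    have e4 := congrArg (fun L : E →L[ℝ] ℝ => L x) e3
    simp [hΦ] at e4
    simp
    linarith

end CotangentCharts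

section Extension

/-! ### Extension of tangent vectors to smooth vector fields -/

/-- Bump functions on `T^*M` require it to be Hausdorff. Points of one fibre are separated in a
trivialisation, all others by the projection. -/
theorem t2Space_totalSpace {B F : Type*} {V : B → Type*} [TopologicalSpace B]
    [TopologicalSpace F] [TopologicalSpace (TotalSpace F V)] [∀ b, TopologicalSpace (V b)]
    [FiberBundle F V] [T2Space B] [T2Space F] : T2Space (TotalSpace F V) := by
  refine ⟨fun p q hpq => ?_⟩
  by_cases h : p.1 = q.1
  · set e := trivializationAt F V p.1
    have hp : p ∈ e.source := FiberBundle.mem_trivializationAt_proj_source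
    have hq : q ∈ e.source := by
      rw [e.mem_source, ← h]; exact FiberBundle.mem_baseSet_trivializationAt F V p.1
    obtain ⟨u, v, hu, hv, hpu, hqv, huv⟩ :=
      t2_separation (fun h => hpq (e.injOn hp hq h) : e p ≠ e q)
    refine ⟨e.source ∩ e ⁻¹' u, e.source ∩ e ⁻¹' v, e.isOpen_inter_preimage hu,
      e.isOpen_inter_preimage hv, ⟨hp, hpu⟩, ⟨hq, hqv⟩, ?_⟩
    exact (huv.preimage e).mono inter_subset_right inter_subset_right
  · obtain ⟨u, v, hu, hv, hpu, hqv, huv⟩ := t2_separation h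
    have hc := FiberBundle.continuous_proj F V
    exact ⟨_, _, hu.preimage hc, hv.preimage hc, hpu, hqv, huv.preimage _⟩

/-- A local smooth extension is cut off by a bump function. Integrability quantifies over global
fields, so this is what gives access to arbitrary tangent vectors. -/
theorem exists_smooth_vectorField {F : Type*} [NormedAddCommGroup F] [NormedSpace ℝ F]
    [FiniteDimensional ℝ F] {H : Type*} [TopologicalSpace H] (I : ModelWithCorners ℝ F H)
    {N : Type*} [TopologicalSpace N] [ChartedSpace H N] [IsManifold I ∞ N] [T2Space N] (p : N)
    (v : TangentSpace I p) :
    ∃ X : ∀ q : N, TangentSpace I q, ContMDiff I I.tangent ∞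
      (fun q => (⟨q, X q⟩ : TangentBundle I N)) ∧ X p = v := by
  have : IsManifold I (∞ + 1) N := by simpa using (inferInstance : IsManifold I ∞ N)
  have : ContMDiffVectorBundle ∞ F (TangentSpace I : N → Type _) I :=
    TangentBundle.contMDiffVectorBundle
  obtain ⟨s, hs, hsσ⟩ := FiberBundle.exists_contMDiffOn_extend (k := ∞) I F v
  obtain ⟨f, -, hf⟩ := (SmoothBumpFunction.nhds_basis_tsupport (I := I) p).mem_iff.1
    (interior_mem_nhds.2 hs)
  refine ⟨(f : N → ℝ) • FiberBundle.extend F v,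
    ContMDiffOn.smul_section_of_tsupport (u := interior s) f.contMDiff.contMDiffOn
      isOpen_interior ?_ (hsσ.mono interior_subset), ?_⟩
  · exact hf
  · rw [Pi.smul_apply', f.eq_one, FiberBundle.extend_apply_self, one_smul]

end Extension

/-! ### Lie brackets on a manifold computed in a chart -/

section LieBracket

open VectorField

variable {F : Type*} [NormedAddCommGroup F] [NormedSpace ℝ F] {H : Type*} [TopologicalSpace H]
  {I : ModelWithCorners ℝ F H} {N : Type*} [TopologicalSpace N] [ChartedSpace H N]
  [IsManifold I 1 N]

variable (I) in
/-- A vector field read in the chart around `p`. -/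
def fieldInChart (p : N) (X : ∀ q : N, TangentSpace I q) (z : F) : F :=
  tangentCoordChange I ((extChartAt I p).symm z) p ((extChartAt I p).symm z)
    (X ((extChartAt I p).symm z))

theorem mpullbackWithin_extChartAt_symm (p : N) (X : ∀ q : N, TangentSpace I q) {z : F}
    (hz : z ∈ (extChartAt I p).target) :
    mpullbackWithin 𝓘(ℝ, F) I (extChartAt I p).symm X (range I) z = fieldInChart I p X z := by
  have h1 := mfderivWithin_extChartAt_symm_comp_mfderiv_extChartAt (I := I) hz
  have h2 := mfderiv_extChartAt_comp_mfderivWithin_extChartAt_symm (I := I) hz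
  have hs : (extChartAt I p).symm z ∈ (chartAt H p).source := by
    rw [← extChartAt_source I]; exact (extChartAt I p).map_target hz
  rw [mfderiv_extChartAt_eq_tangentCoordChange hs] at h1 h2
  have h3 := ContinuousLinearMap.inverse_eq h1 h2
  rw [mpullbackWithin_apply]
  exact congrArg (fun L : F →L[ℝ] F => L (X ((extChartAt I p).symm z))) h3

/-- The chart around `p` has identity derivative at `p`, so the bracket computed in the chart needs
no transport back. -/
theorem mlieBracket_eq_lieBracket (hI : range I = univ) (p : N)
    (X Y : ∀ q : N, TangentSpace I q) :
    mlieBracket I X Y p = lieBracket ℝ (fieldInChart I p X) (fieldInChart I p Y)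
      (extChartAt I p p) := by
  have h1 : (extChartAt I p).target ∈ 𝓝 (extChartAt I p p) := by
    have := extChartAt_target_mem_nhdsWithin (I := I) p
    rwa [hI, nhdsWithin_univ] at this
  have hX (X : ∀ q : N, TangentSpace I q) :
      mpullbackWithin 𝓘(ℝ, F) I (extChartAt I p).symm X (range I) =ᶠ[𝓝 (extChartAt I p p)]
        fieldInChart I p X :=
    Filter.eventually_of_mem h1 fun z hz => mpullbackWithin_extChartAt_symm p X hz
  have h2 := Filter.EventuallyEq.lieBracket_vectorField_eq (𝕜 := ℝ) (hX X) (hX Y)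
  rw [← mlieBracketWithin_univ, mlieBracketWithin_apply, preimage_univ, univ_inter]
  have h3 : (lieBracketWithin ℝ (mpullbackWithin 𝓘(ℝ, F) I (extChartAt I p).symm X (range I))
      (mpullbackWithin 𝓘(ℝ, F) I (extChartAt I p).symm Y (range I)) (range I)
      (extChartAt I p p) : F) = lieBracket ℝ (fieldInChart I p X) (fieldInChart I p Y)
      (extChartAt I p p) := by
    have aux : ∀ V W : F → F, lieBracketWithin ℝ V W (range I) = lieBracket ℝ V W := fun V W => by
      rw [hI, lieBracketWithin_univ]
    exact (congrFun (aux _ _) _).trans h2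
  have h4 : (mfderiv I 𝓘(ℝ, F) (extChartAt I p) p).inverse = ContinuousLinearMap.id ℝ F := by
    rw [mfderiv_extChartAt_self]
    exact ContinuousLinearMap.inverse_id
  exact (congrArg (fun L : F →L[ℝ] F => L _) h4).trans h3

theorem differentiableAt_fieldInChart [CompleteSpace F] [IsManifold I 2 N] (hI : range I = univ)
    {p : N} {X : ∀ q : N, TangentSpace I q} (hX : MDifferentiableAt I I.tangent
      (fun q => (⟨q, X q⟩ : TangentBundle I N)) p) :
    DifferentiableAt ℝ (fieldInChart I p X) (extChartAt I p p) := by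
  have h1 : (extChartAt I p).target ∈ 𝓝 (extChartAt I p p) := by
    have := extChartAt_target_mem_nhdsWithin (I := I) p
    rwa [hI, nhdsWithin_univ] at this
  have h := hX.mdifferentiableWithinAt (s := univ)
    |>.differentiableWithinAt_mpullbackWithin_vectorField
  rw [preimage_univ, univ_inter] at h
  have h2 := (h.differentiableAt (by rw [hI]; exact Filter.univ_mem))
  exact h2.congr_of_eventuallyEq (Filter.EventuallyEq.symm
    (Filter.eventually_of_mem h1 fun z hz => mpullbackWithin_extChartAt_symm p X hz))

theorem fieldInChart_self (p : N) (X : ∀ q : N, TangentSpace I q) :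
    fieldInChart I p X (extChartAt I p p) = X p := by
  have h : ∀ q : N, q = p → (tangentCoordChange I q p q (X q) : F) = X p := by
    rintro q rfl
    exact tangentCoordChange_self (mem_extChartAt_source q)
  exact h _ (extChartAt_to_inv p)

end LieBracket

/-! ### The Nijenhuis tensor of `naturalJ` in a chart -/

section Integrability

open VectorField

variable {E : Type*} [NormedAddCommGroup E] [NormedSpace ℝ E] [FiniteDimensional ℝ E]
  {M : Type*} [TopologicalSpace M] [ChartedSpace E M]
  [IsManifold 𝓘(ℝ, E) ∞ M] (g : Metric E M) {a₁ a₂ b₁ b₂ : ℝ → ℝ}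

/-- The identity is transported through the chart at every point of its target, because it will be
differentiated. -/
theorem modelJ_modelJ (hJ : IsAlmostComplex (naturalJ g a₁ a₂ b₁ b₂)) (p : CotangentBundle E M)
    {z : E × (E →L[ℝ] ℝ)} (hz : z ∈ (extChartAt (cotangentModel E) p).target)
    (v : E × (E →L[ℝ] ℝ)) :
    modelJ a₁ a₂ b₁ b₂ (metricInChart g p.1) z (modelJ a₁ a₂ b₁ b₂ (metricInChart g p.1) z v) =
      -v := by
  obtain ⟨q, hq, rfl⟩ : ∃ q ∈ (extChartAt (cotangentModel E) p).source,
      extChartAt (cotangentModel E) p q = z :=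
    ⟨_, (extChartAt (cotangentModel E) p).map_target hz,
      (extChartAt (cotangentModel E) p).right_inv hz⟩
  have hq1 := mem_cotangentChart_source.1 hq
  obtain ⟨w, rfl⟩ : ∃ w, cotangentChartDeriv p q w = v :=
    ⟨tangentCoordChange (cotangentModel E) p q q v, by
      have hqq := mem_extChartAt_source (I := cotangentModel E) q
      rw [cotangentChartDeriv, tangentCoordChange_comp ⟨⟨hq, hqq⟩, hq⟩,
        tangentCoordChange_self hq]⟩
  rw [← cotangentChartDeriv_naturalJ g _ _ _ _ hq1, ← cotangentChartDeriv_naturalJ g _ _ _ _ hq1,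
    ← map_neg]
  exact congrArg (cotangentChartDeriv p q) (hJ q w)

theorem fieldInChart_naturalJ (p : CotangentBundle E M)
    (X : ∀ q, TangentCotangent (E := E) (M := M) q)
    {z : E × (E →L[ℝ] ℝ)} (hz : z ∈ (extChartAt (cotangentModel E) p).target) :
    fieldInChart (cotangentModel E) p (fun q => naturalJ g a₁ a₂ b₁ b₂ q (X q)) z =
      modelJ a₁ a₂ b₁ b₂ (metricInChart g p.1) z (fieldInChart (cotangentModel E) p X z) := by
  have h := cotangentChartDeriv_naturalJ g a₁ a₂ b₁ b₂ (p := p)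
    (mem_cotangentChart_source.1 ((extChartAt (cotangentModel E) p).map_target hz))
    (X ((extChartAt (cotangentModel E) p).symm z))
  rw [(extChartAt (cotangentModel E) p).right_inv hz] at h
  exact h

/-- The Nijenhuis tensor field of `naturalJ` computed in a chart. -/
theorem nijenhuis_eq_nijenhuisTensor
    (ha₁ : ContDiffOn ℝ ∞ a₁ (Ici 0)) (ha₂ : ContDiffOn ℝ ∞ a₂ (Ici 0))
    (hb₁ : ContDiffOn ℝ ∞ b₁ (Ici 0)) (hb₂ : ContDiffOn ℝ ∞ b₂ (Ici 0))
    (hJ : IsAlmostComplex (naturalJ g a₁ a₂ b₁ b₂))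
    {X Y : ∀ q, TangentCotangent (E := E) (M := M) q}
    (hX : IsSmoothField X) (hY : IsSmoothField Y) (p : CotangentBundle E M) :
    nijenhuis (naturalJ g a₁ a₂ b₁ b₂) X Y p = nijenhuisTensor
      (modelJ a₁ a₂ b₁ b₂ (metricInChart g p.1)) (extChartAt (cotangentModel E) p p)
        (X p) (Y p) := by
  have hI := range_cotangentModel (E := E)
  have hzt := mem_extChartAt_target (I := cotangentModel E) p
  set z := extChartAt (cotangentModel E) p p with hz
  set J := modelJ a₁ a₂ b₁ b₂ (metricInChart g p.1) with hJdef
  have h1 : (extChartAt (cotangentModel E) p).target ∈ 𝓝 z := by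
    have := extChartAt_target_mem_nhdsWithin (I := cotangentModel E) p
    rwa [hI, nhdsWithin_univ] at this
  have hrep (X : ∀ q, TangentCotangent (E := E) (M := M) q) :
      fieldInChart (cotangentModel E) p (fun q => naturalJ g a₁ a₂ b₁ b₂ q (X q)) =ᶠ[𝓝 z]
        fun z => J z (fieldInChart (cotangentModel E) p X z) :=
    Filter.eventually_of_mem h1 fun z hz => fieldInChart_naturalJ g p X hz
  have hJp (v : E × (E →L[ℝ] ℝ)) : naturalJAt g a₁ a₂ b₁ b₂ p v = J z v := by
    rw [naturalJ_eq_modelJ, hz, cotangentChart_self]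
  have hdiff : DifferentiableAt ℝ J z := by
    refine (isMetricOn_metricInChart g p.1).differentiableAt_modelJ ?_ ha₁ ha₂ hb₁ hb₂
    rw [hz, cotangentChart_self]
    exact mem_extChartAt_target (I := 𝓘(ℝ, E)) p.1
  have hfield {X : ∀ q, TangentCotangent (E := E) (M := M) q} (hX : IsSmoothField X) :
      DifferentiableAt ℝ (fieldInChart (cotangentModel E) p X) z :=
    differentiableAt_fieldInChart hI ((hX p).mdifferentiableAt (by simp))
  let B (X Y : ∀ q, TangentCotangent (E := E) (M := M) q) : E × (E →L[ℝ] ℝ) :=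
    mlieBracket (cotangentModel E) X Y p
  have hbr (X Y : ∀ q, TangentCotangent (E := E) (M := M) q) : B X Y =
      lieBracket ℝ (fieldInChart (cotangentModel E) p X) (fieldInChart (cotangentModel E) p Y) z :=
    mlieBracket_eq_lieBracket hI p X Y
  set X' := fieldInChart (cotangentModel E) p X with hX'
  set Y' := fieldInChart (cotangentModel E) p Y with hY'
  have e1 := (hbr (fun q => naturalJ g a₁ a₂ b₁ b₂ q (X q))
    (fun q => naturalJ g a₁ a₂ b₁ b₂ q (Y q))).trans
    (Filter.EventuallyEq.lieBracket_vectorField_eq (𝕜 := ℝ) (hrep X) (hrep Y))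
  have e2 := (hbr (fun q => naturalJ g a₁ a₂ b₁ b₂ q (X q)) Y).trans
    (Filter.EventuallyEq.lieBracket_vectorField_eq (𝕜 := ℝ) (hrep X) (.refl _ Y'))
  have e3 := (hbr X (fun q => naturalJ g a₁ a₂ b₁ b₂ q (Y q))).trans
    (Filter.EventuallyEq.lieBracket_vectorField_eq (𝕜 := ℝ) (.refl _ X') (hrep Y))
  have e4 := modelNijenhuis_eq_tensor hdiff (hfield hX) (hfield hY) (modelJ_modelJ g hJ p hzt)
  rw [fieldInChart_self, fieldInChart_self] at e4
  refine Eq.trans ?_ e4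
  have e5 : (nijenhuis (naturalJ g a₁ a₂ b₁ b₂) X Y p : E × (E →L[ℝ] ℝ)) =
      B (fun q => naturalJ g a₁ a₂ b₁ b₂ q (X q)) (fun q => naturalJ g a₁ a₂ b₁ b₂ q (Y q))
      - naturalJAt g a₁ a₂ b₁ b₂ p (B (fun q => naturalJ g a₁ a₂ b₁ b₂ q (X q)) Y)
      - naturalJAt g a₁ a₂ b₁ b₂ p (B X (fun q => naturalJ g a₁ a₂ b₁ b₂ q (Y q)))
      - B X Y := rfl
  refine e5.trans ?_
  rw [hJp, hJp, e1, e2, e3, hbr]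
  rfl

end Integrability

/-! ### Integrability as a curvature condition on the base -/

section Integrability

variable {E : Type*} [NormedAddCommGroup E] [NormedSpace ℝ E] [FiniteDimensional ℝ E]
  {M : Type*} [TopologicalSpace M] [ChartedSpace E M]
  [IsManifold 𝓘(ℝ, E) ∞ M] (g : Metric E M) {a₁ a₂ b₁ b₂ : ℝ → ℝ}

/-- Integrability of `naturalJ` in terms of the curvature of the base. -/
theorem isIntegrable_naturalJ_iff [T2Space M]
    (ha₁ : ContDiffOn ℝ ∞ a₁ (Ici 0)) (ha₂ : ContDiffOn ℝ ∞ a₂ (Ici 0))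
    (hb₁ : ContDiffOn ℝ ∞ b₁ (Ici 0)) (hb₂ : ContDiffOn ℝ ∞ b₂ (Ici 0))
    (hJ : IsAlmostComplex (naturalJ g a₁ a₂ b₁ b₂)) :
    IsIntegrable (naturalJ g a₁ a₂ b₁ b₂) ↔ ∀ (x : M) (p : E →L[ℝ] ℝ) (u v : E),
      p.comp (modelCurvatureEnd (modelChristoffel (metricInChart g x)) (extChartAt 𝓘(ℝ, E) x x) u v)
        = (let t := 1 / 2 * p ((metricAt g x).inverse p)
          (a₁ t + 2 * t * b₁ t) * derivWithin a₁ (Ici 0) t - a₁ t * b₁ t) •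
          (p u • metricAt g x v - p v • metricAt g x u) := by
  have hmetric (x : M) := isMetricOn_metricInChart g x
  have hy (x : M) := mem_extChartAt_target (I := 𝓘(ℝ, E)) x
  have hpoint (x : M) (p : E →L[ℝ] ℝ) : ∃ q : CotangentBundle E M, q.1 = x ∧
      extChartAt (cotangentModel E) q q = (extChartAt 𝓘(ℝ, E) x x, p) :=
    ⟨⟨x, p⟩, rfl, cotangentChart_self _⟩
  have hJJ (q : CotangentBundle E M) := modelJ_modelJ g hJ q
    (mem_extChartAt_target (I := cotangentModel E) q)
  have hhor (q : CotangentBundle E M) := (hmetric q.1).nijenhuisTensor_horizontal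
    (z := extChartAt (cotangentModel E) q q) (by rw [cotangentChart_self]; exact hy q.1)
    ha₁ ha₂ hb₁ hb₂ (hJJ q)
  constructor
  · intro h x p u v
    obtain ⟨q, rfl, hq⟩ := hpoint x p
    have : T2Space (CotangentBundle E M) := t2Space_totalSpace
    have h0 (u v : E × (E →L[ℝ] ℝ)) : nijenhuisTensor
        (modelJ a₁ a₂ b₁ b₂ (metricInChart g q.1)) (extChartAt (cotangentModel E) q q) u v = 0 := by
      obtain ⟨X, hX, rfl⟩ := exists_smooth_vectorField (cotangentModel E) q u
      obtain ⟨Y, hY, rfl⟩ := exists_smooth_vectorField (cotangentModel E) q v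
      rw [← nijenhuis_eq_nijenhuisTensor g ha₁ ha₂ hb₁ hb₂ hJ hX hY q]
      exact h X Y hX hY q
    have h1 := congrArg Prod.snd ((hhor q u v).symm.trans (h0 _ _))
    rw [hq] at h1
    have h2 := sub_eq_zero.1 h1
    simp only [modelEnergy] at h2
    rw [metricInChart_self] at h2
    exact h2.symm
  · intro h X Y hX hY q
    refine (nijenhuis_eq_nijenhuisTensor g ha₁ ha₂ hb₁ hb₂ hJ hX hY q).trans ?_
    have hz : (extChartAt (cotangentModel E) q).target ∈ 𝓝 (extChartAt (cotangentModel E) q q) := by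
      have := extChartAt_target_mem_nhdsWithin (I := cotangentModel E) q
      rwa [range_cotangentModel, nhdsWithin_univ] at this
    refine nijenhuisTensor_eq_zero_of_span ?_ (Filter.eventually_of_mem hz fun z hz =>
      modelJ_modelJ g hJ q hz) (exists_horizontal_add_modelJ (hJJ q)) ?_ _ _
    · refine (hmetric q.1).differentiableAt_modelJ ?_ ha₁ ha₂ hb₁ hb₂
      rw [cotangentChart_self]
      exact hy q.1
    · rintro _ ⟨u, rfl⟩ _ ⟨v, rfl⟩
      rw [hhor q u v]
      refine Prod.ext rfl ?_
      have h1 := h q.1 (covectorAt q) u v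
      simp only [cotangentChart_self, modelEnergy]
      rw [h1, metricInChart_self]
      exact sub_self _

end Integrability

section Coefficients

/-! ### The differential equation for the coefficients -/

/-- A solution of a linear homogeneous differential equation that does not vanish initially never
vanishes. -/
theorem ne_zero_of_hasDerivWithinAt_mul {f k : ℝ → ℝ} (hk : ContinuousOn k (Ici 0))
    (hf : ∀ t, 0 ≤ t → HasDerivWithinAt f (k t * f t) (Ici 0) t) (h0 : f 0 ≠ 0) {t : ℝ}
    (ht : 0 ≤ t) : f t ≠ 0 := by
  intro hft
  obtain ⟨K, hK⟩ := isCompact_Icc.exists_bound_of_continuousOn 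
    (hk.mono (Icc_subset_Ici_self : Icc 0 t ⊆ Ici 0))
  have hcont : ContinuousOn f (Icc 0 t) := fun s hs =>
    (hf s hs.1).continuousWithinAt.mono Icc_subset_Ici_self
  -- Uniqueness runs backwards from `t`: if `f` vanishes there, it agrees with the zero solution
  -- down to `0`.
  have h := ODE_solution_unique_of_mem_Icc_left (v := fun t y => k t * y) (s := fun _ => univ)
    (K := K.toNNReal) (f := f) (g := fun _ => 0) (a := 0) (b := t)
    (fun s hs => by
      refine LipschitzOnWith.of_dist_le_mul fun x _ y _ => ?_
      rw [Real.dist_eq, Real.dist_eq, ← mul_sub, abs_mul]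
      have h1 := hK s ⟨hs.1.le, hs.2⟩
      rw [Real.norm_eq_abs] at h1
      exact mul_le_mul_of_nonneg_right (h1.trans (Real.le_coe_toNNReal K)) (abs_nonneg _))
    hcont (fun s hs => ((hf s hs.1.le).hasDerivAt (Ici_mem_nhds hs.1)).hasDerivWithinAt)
    (fun _ _ => mem_univ _) continuousOn_const
    (fun s _ => by simpa using hasDerivWithinAt_const s (Iic s) (0 : ℝ))
    (fun _ _ => mem_univ _) hft
  exact h0 (h ⟨le_rfl, ht⟩)

/-- The integrability condition on the coefficients `a` and `b` determines `b`. -/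
theorem coefficient_eq_div {a b : ℝ → ℝ} {c : ℝ} (ha : ContDiffOn ℝ ∞ a (Ici 0))
    (hb : ContDiffOn ℝ ∞ b (Ici 0)) (hpos : ∀ t, 0 ≤ t → 0 < a t ∧ 0 < a t + 2 * t * b t)
    (hc : ∀ t, 0 ≤ t → (a t + 2 * t * b t) * derivWithin a (Ici 0) t - a t * b t = c) {t : ℝ}
    (ht : 0 ≤ t) : a t - 2 * t * derivWithin a (Ici 0) t ≠ 0 ∧
      b t = (a t * derivWithin a (Ici 0) t - c) / (a t - 2 * t * derivWithin a (Ici 0) t) := by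
  have hD (s : ℝ) (hs : 0 ≤ s) : (a s + 2 * s * b s) * (a s - 2 * s * derivWithin a (Ici 0) s) =
      a s ^ 2 - 2 * c * s := by
    linear_combination (-2 * s) * hc s hs
  -- By `hc`, the derivative of `f = a² - 2 c s` is `2 (a a' - c) = 2 b (a - 2 s a')`, and `hD`
  -- turns this into `2 b f / (a + 2 s b)`.
  have hne : a t ^ 2 - 2 * c * t ≠ 0 := by
    refine ne_zero_of_hasDerivWithinAt_mul (f := fun s => a s ^ 2 - 2 * c * s)
      (k := fun s => 2 * b s / (a s + 2 * s * b s)) ?_ (fun s hs => ?_) ?_ ht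
    · refine (continuousOn_const.mul hb.continuousOn).div (ha.continuousOn.add
        ((continuousOn_const.mul continuousOn_id).mul hb.continuousOn)) fun s hs => ?_
      exact (hpos s hs).2.ne'
    · have h1 := ((ha.differentiableOn (by simp)) s hs).hasDerivWithinAt
      refine ((h1.pow 2).sub ((hasDerivWithinAt_id s _).const_mul (2 * c))).congr_deriv ?_
      have h2 := (hpos s hs).2.ne'
      rw [← hD s hs, ← hc s hs]
      field_simp
      simp
      ring
    · simpa using (hpos 0 le_rfl).1.ne'
  rw [← hD t ht] at hne
  have h1 := right_ne_zero_of_mul hne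
  refine ⟨h1, ?_⟩
  rw [eq_div_iff h1, ← hc t ht]
  ring

end Coefficients

/-! ### Constant sectional curvature and the curvature condition -/

section ConstantCurvature

variable {E : Type*} [NormedAddCommGroup E] [NormedSpace ℝ E]

/-- Cauchy–Schwarz inequality for linearly independent vectors. -/
theorem gram_pos {B : E →L[ℝ] E →L[ℝ] ℝ} (hsymm : ∀ u v, B u v = B v u)
    (hpos : ∀ u, u ≠ 0 → 0 < B u u) {u v : E} (huv : LinearIndependent ℝ ![u, v]) :
    0 < B u u * B v v - B u v ^ 2 := by
  have hu : u ≠ 0 := huv.ne_zero 0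
  have h1 := hpos u hu
  -- This is `B u u` times the component of `v` orthogonal to `u`; its square is `B u u` times the
  -- Gram determinant.
  have h2 := hpos (B u u • v - B u v • u) fun h => by
    have := LinearIndependent.pair_iff.1 huv (-B u v) (B u u) (by rw [← h]; module)
    exact h1.ne' this.2
  have h3 : B (B u u • v - B u v • u) (B u u • v - B u v • u) =
      B u u * (B u u * B v v - B u v ^ 2) := by
    simp only [map_sub, map_smul, sub_apply, smul_apply, smul_eq_mul, hsymm v u]
    ring
  rw [h3] at h2
  exact pos_of_mul_pos_right h2 h1.le

variable {M : Type*} [TopologicalSpace M] [ChartedSpace E M] [IsManifold 𝓘(ℝ, E) ∞ M]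
  (g : Metric E M)

/-- The curvature tensor as a map of the model space. -/
def curvatureAt (x : M) (u v : E) : E →L[ℝ] E :=
  modelCurvatureEnd (modelChristoffel (metricInChart g x)) (extChartAt 𝓘(ℝ, E) x x) u v

theorem metricAt_symm (x : M) (u v : E) : metricAt g x u v = metricAt g x v u := g.symm x u v

theorem metricAt_pos (x : M) (u : E) (hu : u ≠ 0) : 0 < metricAt g x u u := g.pos x u hu

theorem hasConstantSectionalCurvature_iff (c : ℝ) :
    HasConstantSectionalCurvature g c ↔ ∀ (x : M) (u v : E), LinearIndependent ℝ ![u, v] →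
      metricAt g x (curvatureAt g x u v v) u =
        c * (metricAt g x u u * metricAt g x v v - metricAt g x u v ^ 2) := by
  have h (x : M) (u v : E) (huv : LinearIndependent ℝ ![u, v]) :
      metricAt g x (curvatureAt g x u v v) u /
        (metricAt g x u u * metricAt g x v v - metricAt g x u v ^ 2) = c ↔
      metricAt g x (curvatureAt g x u v v) u =
        c * (metricAt g x u u * metricAt g x v v - metricAt g x u v ^ 2) :=
    div_eq_iff (gram_pos (metricAt_symm g x) (metricAt_pos g x) huv).ne'
  exact ⟨fun H x u v huv => (h x u v huv).1 (H x u v huv),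
    fun H x u v huv => (h x u v huv).2 (H x u v huv)⟩

variable [FiniteDimensional ℝ E]

/-- The difference of the two sides is an algebraic curvature tensor with zero sectional curvatures;
for dependent `u`, `v` both sides vanish by skewness. -/
theorem IsMetricOn.curvature_eq_of_sectional {G : E → E →L[ℝ] E →L[ℝ] ℝ} {s : Set E}
    (hG : IsMetricOn G s) {y : E} (hy : y ∈ s) {c : ℝ}
    (hc : ∀ u v, LinearIndependent ℝ ![u, v] → G y (modelCurvature (modelChristoffel G) y u v v) u
      = c * (G y u u * G y v v - G y u v ^ 2)) (u v w z : E) :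
    G y (modelCurvature (modelChristoffel G) y u v w) z =
      c * (G y v w * G y u z - G y u w * G y v z) := by
  set Γ := modelChristoffel G
  have hs := hG.symm y hy
  have key := algebraicCurvature_eq_zero (S := fun u v w z =>
    G y (modelCurvature Γ y u v w) z - c * (G y v w * G y u z - G y u w * G y v z))
    ?_ ?_ ?_ ?_ ?_ u v w z
  · exact sub_eq_zero.1 key
  · intro u v v' w z
    simp only [modelCurvature, map_add, map_sub, add_apply, sub_apply]
    ring
  · intro u v w z
    simp only [modelCurvature_swap Γ y v u, map_neg, neg_apply]
    ring
  · intro u v w z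
    rw [hG.curvature_skew hy u v z w]
    ring
  · intro u v w z
    have h := congrArg (fun L => G y L z) (hG.curvature_cyclic hy u v w)
    simp only [map_add, add_apply, map_zero, zero_apply] at h
    rw [hs v u, hs w u, hs w v]
    linear_combination h
  · intro u v
    by_cases huv : LinearIndependent ℝ ![u, v]
    · have := hc u v huv
      rw [hs v u]
      linear_combination this
    · have hskew : ∀ w, modelCurvature Γ y w w = 0 := fun w => by
        ext x
        simp [modelCurvature]
      rw [LinearIndependent.pair_iff] at huv
      push Not at huv
      obtain ⟨α, β, h, hne⟩ := huv
      by_cases hα : α = 0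
      · have hv : v = 0 := by
          subst hα
          simpa [hne rfl] using h
        subst hv
        simp [modelCurvature]
      · obtain ⟨r, rfl⟩ : ∃ r : ℝ, u = r • v := ⟨-(α⁻¹ * β), by
          rw [neg_smul, mul_smul, ← sub_eq_zero, sub_neg_eq_add]
          rw [← smul_right_injective E hα |>.eq_iff]
          simpa [smul_smul, hα] using h⟩
        have h1 : modelCurvature Γ y (r • v) v v = 0 := by
          simp [modelCurvature]
        rw [h1]
        simp only [map_smul, smul_apply, smul_eq_mul, map_zero, zero_apply]
        ring

/-- Every covector is `g_z` for some `z`, so this is the space-form identity for `R` paired with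
`z`. -/
theorem HasConstantSectionalCurvature.comp_curvatureAt {c : ℝ}
    (h : HasConstantSectionalCurvature g c) (x : M) (p : E →L[ℝ] ℝ) (u v : E) :
    p.comp (curvatureAt g x u v) = c • (p u • metricAt g x v - p v • metricAt g x u) := by
  have hy := mem_extChartAt_target (I := 𝓘(ℝ, E)) x
  have hG := isMetricOn_metricInChart g x
  obtain ⟨z, rfl⟩ : ∃ z, metricAt g x z = p :=
    (isInvertible_of_pos (metricAt_pos g x)).surjective p
  have key := hG.curvature_eq_of_sectional hy (c := c) (by
    rw [metricInChart_self]; exact (hasConstantSectionalCurvature_iff g c).1 h x)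
  rw [metricInChart_self] at key
  ext w
  have h1 := key u v w z
  have h2 := metricAt_symm g x
  simp only [ContinuousLinearMap.comp_apply, smul_apply, sub_apply, smul_eq_mul]
  rw [h2 z, h2 z u, h2 z v]
  refine Eq.trans h1 ?_
  ring

/-- If the curvature is pointwise a multiple, depending on the energy density only, of that of a
space form, then the multiple is a constant. -/
theorem exists_hasConstantSectionalCurvature [Nonempty M] (hn : 2 ≤ Module.finrank ℝ E)
    {φ : ℝ → ℝ} (hφ : ContinuousOn φ (Ici 0))
    (h : ∀ (x : M) (p : E →L[ℝ] ℝ) (u v : E), p.comp (curvatureAt g x u v) =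
      φ (1 / 2 * p ((metricAt g x).inverse p)) • (p u • metricAt g x v - p v • metricAt g x u)) :
    ∃ c, HasConstantSectionalCurvature g c ∧ ∀ t, 0 ≤ t → φ t = c := by
  -- Take `p = r g_u`: its energy is `r² g(u, u) / 2`, while the factor `r` cancels by linearity.
  have hsec (x : M) (u v : E) (r : ℝ) (hr : r ≠ 0) : metricAt g x (curvatureAt g x u v v) u =
      φ (1 / 2 * (r ^ 2 * metricAt g x u u)) *
        (metricAt g x u u * metricAt g x v v - metricAt g x u v ^ 2) := by
    have h1 := congrArg (fun L : E →L[ℝ] ℝ => L v) (h x (r • metricAt g x u) u v)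
    have h2 : (metricAt g x).inverse (metricAt g x u) = u :=
      congrArg (fun L : E →L[ℝ] E => L u)
        (isInvertible_of_pos (metricAt_pos g x)).inverse_comp_self
    have hsymm := metricAt_symm g x
    simp only [ContinuousLinearMap.comp_apply, smul_apply, sub_apply, smul_eq_mul, map_smul,
      h2] at h1
    rw [hsymm (curvatureAt g x u v v)]
    have h3 : r * (r * metricAt g x u u) = r ^ 2 * metricAt g x u u := by ring
    rw [h3] at h1
    refine mul_left_cancel₀ hr (h1.trans ?_)
    ring
  obtain ⟨x₀⟩ := ‹Nonempty M›
  obtain ⟨f, hf⟩ := exists_linearIndependent_of_le_finrank hn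
  obtain ⟨u₀, v₀, huv⟩ : ∃ u v : E, LinearIndependent ℝ ![u, v] :=
    ⟨f 0, f 1, by convert hf; ext i; fin_cases i <;> rfl⟩
  have hu := metricAt_pos g x₀ u₀ (huv.ne_zero 0)
  have hgram := gram_pos (metricAt_symm g x₀) (metricAt_pos g x₀) huv
  -- One plane at one point suffices: `r = √(2 t / g(u₀, u₀))` realises each energy `t > 0`, and the
  -- sectional curvature does not depend on `r`.
  have hφpos : EqOn φ (fun _ => φ (1 / 2 * (1 ^ 2 * metricAt g x₀ u₀ u₀))) (Ioi 0) := by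
    intro t ht
    have h1 : 0 < 2 * t / metricAt g x₀ u₀ u₀ := div_pos (mul_pos two_pos ht) hu
    have h2 := hsec x₀ u₀ v₀ _ (Real.sqrt_pos.2 h1).ne'
    rw [Real.sq_sqrt h1.le, div_mul_cancel₀ _ hu.ne', one_div, inv_mul_cancel_left₀ two_ne_zero,
      hsec x₀ u₀ v₀ 1 one_ne_zero] at h2
    exact (mul_right_cancel₀ hgram.ne' h2).symm
  have hφ0 := hφpos.of_subset_closure hφ continuousOn_const Ioi_subset_Ici_self
    (by rw [closure_Ioi])
  refine ⟨_, (hasConstantSectionalCurvature_iff g _).2 fun x u v huv => ?_, hφ0⟩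
  have hu := metricAt_pos g x u (huv.ne_zero 0)
  rw [hsec x u v 1 one_ne_zero, hφpos (mem_Ioi.2 (by positivity))]

end ConstantCurvature

end CotangentLift

end

theorem theorem3 {E : Type*} [NormedAddCommGroup E] [NormedSpace ℝ E] [FiniteDimensional ℝ E]
    (hn : 2 ≤ Module.finrank ℝ E)
    {M : Type*} [TopologicalSpace M] [T2Space M] [Nonempty M] [ChartedSpace E M]
    [IsManifold 𝓘(ℝ, E) ∞ M] (g : CotangentLift.Metric E M)
    (a₁ a₂ b₁ b₂ : ℝ → ℝ)
    (ha₁ : ContDiffOn ℝ ∞ a₁ (Set.Ici 0)) (ha₂ : ContDiffOn ℝ ∞ a₂ (Set.Ici 0))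
    (hb₁ : ContDiffOn ℝ ∞ b₁ (Set.Ici 0)) (hb₂ : ContDiffOn ℝ ∞ b₂ (Set.Ici 0))
    (hJ : CotangentLift.IsAlmostComplex (CotangentLift.naturalJ g a₁ a₂ b₁ b₂))
    (hpos : ∀ t : ℝ, 0 ≤ t →
      0 < a₁ t ∧ 0 < a₂ t ∧ 0 < a₁ t + 2 * t * b₁ t ∧ 0 < a₂ t + 2 * t * b₂ t) :
    CotangentLift.IsIntegrable (CotangentLift.naturalJ g a₁ a₂ b₁ b₂) ↔
      ∃ c : ℝ, CotangentLift.HasConstantSectionalCurvature g c ∧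
        ∀ t : ℝ, 0 ≤ t →
          a₁ t - 2 * t * derivWithin a₁ (Set.Ici 0) t ≠ 0 ∧
          b₁ t = (a₁ t * derivWithin a₁ (Set.Ici 0) t - c) /
            (a₁ t - 2 * t * derivWithin a₁ (Set.Ici 0) t) := by
  have hφ : ContinuousOn (fun t => (a₁ t + 2 * t * b₁ t) * derivWithin a₁ (Set.Ici 0) t -
      a₁ t * b₁ t) (Set.Ici 0) := by
    have h1 := ha₁.continuousOn_derivWithin (uniqueDiffOn_Ici 0) (by simp)
    have h2 := ha₁.continuousOn
    have h3 := hb₁.continuousOn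
    fun_prop
  rw [CotangentLift.isIntegrable_naturalJ_iff g ha₁ ha₂ hb₁ hb₂ hJ]
  constructor
  · intro h
    obtain ⟨c, hc, hφc⟩ := CotangentLift.exists_hasConstantSectionalCurvature g hn hφ h
    exact ⟨c, hc, fun t ht => CotangentLift.coefficient_eq_div ha₁ hb₁
      (fun t ht => ⟨(hpos t ht).1, (hpos t ht).2.2.1⟩) hφc ht⟩
  · rintro ⟨c, hc, hb⟩ x p u v
    have ht : 0 ≤ 1 / 2 * p ((CotangentLift.metricAt g x).inverse p) :=
      CotangentLift.half_apply_inverse_nonneg (CotangentLift.metricAt_pos g x) p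
    obtain ⟨hne, hbt⟩ := hb _ ht
    refine (CotangentLift.HasConstantSectionalCurvature.comp_curvatureAt g hc x p u v).trans
      (congrArg (fun r : ℝ => r • (p u • CotangentLift.metricAt g x v -
        p v • CotangentLift.metricAt g x u)) ?_)
    -- Cleared of its denominator, the formula for `b₁` says `φ(t) = c`.
    rw [eq_div_iff hne] at hbt
    linear_combination hbt
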